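/- Let $L$ be a finite lattice with minimum $\mathbf 0$ which is graded (with the standard rank function) and atomic (every element is a join of atoms), let $R$ be a commutative ring with $1$, and let $F$ be a sheaf on $L$, i.e. a contravariant functor from the poset $L$ to $R$-modules, with structure maps $F^y_x\colon F(y)\to F(x)$ for $x\le y$. For a poset $P$ with minimum $m$ and a sheaf $F$ on $P$, let $S_n(P\setminus m;F)=\bigoplus_{\sigma}F(x_0)$, the sum over the chains $\sigma=(x_n\le\cdots\le x_0)$ in $P\setminus m=\{x\in P: x\neq m\}$, with differential $d(s_\sigma)=F^{x_0}_{x_1}(s)_{d_0\sigma}+\sum_{i=1}^n(-1)^i s_{d_i\sigma}$, where $d_i$ omits $x_i$ and $s_\sigma$ denotes $s\in F(x_0)$ placed in the summand of $\sigma$. Augment this complex by $\epsilon\colon S_0(P\setminus m;F)\to F(m)$, the sum of the structure maps $F^x_m$. The reduced homology $\widetilde H_i(P\setminus m;F)$ is the homology of the augmented complex at $S_i$, for $i\ge 0$. Restrictions of $F$ to subposets are again denoted by $F$. For an atom $a$ of $L$, let $L_a$ be the subposet of the elements of $L$ that are joins of atoms different from $a$ (with the empty join equal to $\mathbf 0$),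 and let $L^a=\{x\in L: x\ge a\}$; their minima are $\mathbf 0$ and $a$ respectively. Let $a$ be an atom of $L$ such that the map $\epsilon_*\colon\varinjlim^{L^a\setminus a}F\to F(a)$ induced by the structure maps $F^x_a$, $x>a$, is surjective. Then there is a long exact sequence of $R$-modules $$\cdots\to\widetilde H_i(L^a\setminus a;F)\to\widetilde H_i(L_a\setminus\mathbf 0;F)\to\widetilde H_i(L\setminus\mathbf 0;F)\to\widetilde H_{i-1}(L^a\setminus a;F)\to\widetilde H_{i-1}(L_a\setminus\mathbf 0;F)\to\cdots$$ $$\cdots\to\widetilde H_1(L\setminus\mathbf 0;F)\to\widetilde H_0(L^a\setminus a;F)\to\widetilde H_0(L_a\setminus\mathbf 0;F)\to\widetilde H_0(L\setminus\mathbf 0;F)\to 0,$$ in which the maps $\widetilde H_i(L_a\setminus\mathbf 0;F)\to\widetilde H_i(L\setminus\mathbf 0;F)$ are those induced by the inclusion $L_a\hookrightarrow L$. -/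

import Mathlib

open CategoryTheory Opposite

universe u v w

noncomputable section

namespace PosetSheaf

/-- A sheaf on a poset `P`: a contravariant functor from `P` to `R`-modules.  The structure map
`F^y_x : F(y) → F(x)` for `x ≤ y` is `F.map (homOfLE h).op`. -/
abbrev Sheaf (R : Type v) [CommRing R] (P : Type u) [PartialOrder P] :=
  Pᵒᵖ ⥤ ModuleCat.{max u w} R

section Basic

variable {R : Type v} [CommRing R] {P Q : Type u} [PartialOrder P] [PartialOrder Q]

/-- The induced sheaf `f^* F = F ∘ f` on `Q`, for a poset map `f : Q → P`. -/
abbrev Sheaf.pullback (F : Sheaf.{u, v, w} R P) (f : Q →o P) : Sheaf.{u, v, w} R Q :=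
  f.monotone.functor.op ⋙ F

/-- The restriction of a sheaf on `P` to a subposet. -/
abbrev Sheaf.restrict (F : Sheaf.{u, v, w} R P) (U : Set P) : Sheaf.{u, v, w} R U :=
  F.pullback (OrderHom.Subtype.val (· ∈ U))

/-- The `n`-simplices `x_n ≤ ⋯ ≤ x_0` of the nerve of `P`; the vertex `x_i` is `σ i`. -/
abbrev Simplex (P : Type u) [PartialOrder P] (n : ℕ) := Fin (n + 1) →o Pᵒᵈ

instance (n : ℕ) : DecidableEq (Simplex P n) := Classical.decEq _

/-- The vertex `x_i` of a simplex. -/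
def Simplex.vertex {n : ℕ} (σ : Simplex P n) (i : Fin (n + 1)) : P := OrderDual.ofDual (σ i)

theorem Simplex.vertex_le {n : ℕ} (σ : Simplex P n) (i : Fin (n + 1)) :
    σ.vertex i ≤ σ.vertex 0 :=
  σ.monotone (Fin.zero_le i)

/-- The image of a simplex under a poset map. -/
def Simplex.map (f : Q →o P) {n : ℕ} (σ : Simplex Q n) : Simplex P n := f.dual.comp σ

/-- The module of `n`-chains `S_n(P; F) = ⨁_σ F(x_0)`, the sum over all
`n`-simplices `σ = (x_n ≤ ⋯ ≤ x_0)`. -/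
abbrev Chains (F : Sheaf.{u, v, w} R P) (n : ℕ) :=
  DirectSum (Simplex P n) fun σ => F.obj (op (σ.vertex 0))

/-- The element `s_σ` of `S_n(P; F)`, for `s ∈ F(x_0)`. -/
abbrev Chains.single (F : Sheaf.{u, v, w} R P) {n : ℕ} (σ : Simplex P n) :
    F.obj (op (σ.vertex 0)) →ₗ[R] Chains F n :=
  DirectSum.lof R (Simplex P n) (fun σ => F.obj (op (σ.vertex 0))) σ

/-- The linear map `s_σ ↦ F(x_{θ 0} ≤ x_0)(s)_{σ ∘ θ}` associated with a monotone map `θ`. -/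
def Chains.pull (F : Sheaf.{u, v, w} R P) {m n : ℕ} (θ : Fin (m + 1) →o Fin (n + 1)) :
    Chains F n →ₗ[R] Chains F m :=
  DirectSum.toModule R _ _ fun σ =>
    (Chains.single F (σ.comp θ)).comp (F.map (homOfLE (σ.vertex_le (θ 0))).op).hom

@[simp]
theorem Chains.pull_single (F : Sheaf.{u, v, w} R P) {m n : ℕ}
    (θ : Fin (m + 1) →o Fin (n + 1)) (σ : Simplex P n) (s : F.obj (op (σ.vertex 0))) :
    Chains.pull F θ (Chains.single F σ s) =
      Chains.single F (σ.comp θ) (F.map (homOfLE (σ.vertex_le (θ 0))).op s) := by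
  simp only [Chains.pull, Chains.single, DirectSum.toModule_lof]
  rfl

theorem Chains.hom_ext (F : Sheaf.{u, v, w} R P) {n : ℕ} {M : Type*} [AddCommGroup M]
    [Module R M] {f g : Chains F n →ₗ[R] M}
    (h : ∀ (σ : Simplex P n) (s : F.obj (op (σ.vertex 0))),
      f (Chains.single F σ s) = g (Chains.single F σ s)) : f = g :=
  DirectSum.linearMap_ext R fun σ => LinearMap.ext fun s => h σ s

/-- The chains of `P` with coefficients in `F`, as a simplicial module. -/
def simplicialChains (F : Sheaf.{u, v, w} R P) : SimplicialObject (ModuleCat.{max u w} R) where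
  obj n := ModuleCat.of R (Chains F n.unop.len)
  map θ := ModuleCat.ofHom (Chains.pull F θ.unop.toOrderHom)
  map_id n := by
    ext1
    refine Chains.hom_ext F fun σ s => ?_
    refine (Chains.pull_single F _ σ s).trans ?_
    exact congrArg (Chains.single F σ)
      (congrArg (fun φ : F.obj (op (σ.vertex 0)) ⟶ F.obj (op (σ.vertex 0)) => φ s) (F.map_id _))
  map_comp θ θ' := by
    ext1
    refine Chains.hom_ext F fun σ s => ?_
    refine (Chains.pull_single F _ σ s).trans ?_
    refine Eq.trans ?_ (congrArg (Chains.pull F θ'.unop.toOrderHom)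
      (Chains.pull_single F θ.unop.toOrderHom σ s)).symm
    refine Eq.trans ?_ (Chains.pull_single F θ'.unop.toOrderHom
      (σ.comp θ.unop.toOrderHom) _).symm
    refine congrArg (Chains.single F ((σ.comp θ.unop.toOrderHom).comp θ'.unop.toOrderHom)) ?_
    refine Eq.trans ?_ (ConcreteCategory.comp_apply _ _ _)
    refine congrArg (fun φ : F.obj (op (σ.vertex 0)) ⟶ F.obj (op (σ.vertex
      (θ.unop.toOrderHom (θ'.unop.toOrderHom 0)))) => φ s) ?_
    exact F.map_comp (homOfLE _).op (homOfLE _).op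

/-- The chain complex `S_*(P; F)`, with differential the alternating sum of the faces. -/
def chainComplex (F : Sheaf.{u, v, w} R P) : ChainComplex (ModuleCat.{max u w} R) ℕ :=
  (AlgebraicTopology.alternatingFaceMapComplex (ModuleCat.{max u w} R)).obj (simplicialChains F)

/-- The `i`-th face `x_n ≤ ⋯ ≤ x̂_i ≤ ⋯ ≤ x_0` of a simplex. -/
def Simplex.face {n : ℕ} (σ : Simplex P (n + 1)) (i : Fin (n + 2)) : Simplex P n :=
  σ.comp (Fin.succAboveOrderEmb i).toOrderHom

/-- The differential of `S_*(P; F)`: it sends `s_σ` to the alternating sum over `i` of the elements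
`F(x' ≤ x_0)(s)_{d_i σ}`, where `x'` is the vertex number `0` of `d_i σ`
(so `x' = x_1` for `i = 0` and `x' = x_0` for `i > 0`). -/
theorem chainComplex_d_single (F : Sheaf.{u, v, w} R P) {n : ℕ} (σ : Simplex P (n + 1))
    (s : F.obj (op (σ.vertex 0))) :
    ((chainComplex F).d (n + 1) n).hom (Chains.single F σ s) =
      ∑ i : Fin (n + 2), (-1 : ℤ) ^ (i : ℕ) • Chains.single F (σ.face i)
        (F.map (homOfLE (σ.vertex_le (i.succAbove 0))).op s) := by
  have h : ((chainComplex F).d (n + 1) n :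
      ModuleCat.of R (Chains F (n + 1)) ⟶ ModuleCat.of R (Chains F n)) =
      ∑ i : Fin (n + 2), (-1 : ℤ) ^ (i : ℕ) •
        ModuleCat.ofHom (Chains.pull F (Fin.succAboveOrderEmb i).toOrderHom) :=
    AlgebraicTopology.AlternatingFaceMapComplex.obj_d_eq _ n
  refine (congrArg (fun φ : ModuleCat.of R (Chains F (n + 1)) ⟶ ModuleCat.of R (Chains F n) =>
    φ.hom (Chains.single F σ s)) h).trans ?_
  dsimp only
  rw [ModuleCat.hom_sum, LinearMap.sum_apply]
  refine Finset.sum_congr rfl fun i _ => ?_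
  rw [ModuleCat.hom_zsmul]
  exact congrArg (fun c : Chains F n => (-1 : ℤ) ^ (i : ℕ) • c) (Chains.pull_single F _ σ s)

/-- The map of chains `s_σ ↦ s_{f σ}` induced by a poset map `f : Q → P`. -/
def Chains.push (F : Sheaf.{u, v, w} R P) (f : Q →o P) (n : ℕ) :
    Chains (F.pullback f) n →ₗ[R] Chains F n :=
  DirectSum.toModule R _ _ fun σ => Chains.single F (σ.map f)

@[simp]
theorem Chains.push_single (F : Sheaf.{u, v, w} R P) (f : Q →o P) {n : ℕ} (σ : Simplex Q n)
    (s : F.obj (op (f (σ.vertex 0)))) :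
    Chains.push F f n (Chains.single (F.pullback f) σ s) = Chains.single F (σ.map f) s := by
  exact DirectSum.toModule_lof R (M := fun σ : Simplex Q n => (F.pullback f).obj (op (σ.vertex 0)))
    σ s

/-- The simplicial map `s_σ ↦ s_{f σ}`. -/
def simplicialChainsMap (F : Sheaf.{u, v, w} R P) (f : Q →o P) :
    simplicialChains (F.pullback f) ⟶ simplicialChains F where
  app n := ModuleCat.ofHom (Chains.push F f n.unop.len)
  naturality n m θ := by
    ext1
    refine Chains.hom_ext _ fun σ s => ?_
    refine (congrArg (Chains.push F f _) (Chains.pull_single (F.pullback f) _ σ s)).trans ?_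
    refine Eq.trans ?_ (congrArg (Chains.pull F _) (Chains.push_single F f σ s)).symm
    exact (Chains.push_single F f _ _).trans (Chains.pull_single F _ (σ.map f) s).symm

/-- The chain map `S_*(Q; f^* F) → S_*(P; F)`, `s_σ ↦ s_{f σ}`. -/
def chainComplexMap (F : Sheaf.{u, v, w} R P) (f : Q →o P) :
    chainComplex (F.pullback f) ⟶ chainComplex F :=
  (AlgebraicTopology.alternatingFaceMapComplex (ModuleCat.{max u w} R)).map
    (simplicialChainsMap F f)

end Basic

section Reduced

variable {R : Type v} [CommRing R] {P Q : Type u} [PartialOrder P] [PartialOrder Q]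
  [OrderBot P] [OrderBot Q]

/-- The subset `P ∖ 0` of a poset `P` with minimum `0`. -/
def punctured (P : Type u) [PartialOrder P] [OrderBot P] : Set P := {x | x ≠ ⊥}

/-- The augmentation `ε : S_0(P ∖ 0; F) → F(0)`, the sum of the structure maps. -/
def augmentation (F : Sheaf.{u, v, w} R P) :
    Chains (F.restrict (punctured P)) 0 →ₗ[R] F.obj (op ⊥) :=
  DirectSum.toModule R _ _ fun σ =>
    (F.map (homOfLE (bot_le : ⊥ ≤ (σ.vertex 0 : P))).op).hom

@[simp]
theorem augmentation_single (F : Sheaf.{u, v, w} R P) (σ : Simplex (punctured P) 0)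
    (s : F.obj (op (σ.vertex 0 : P))) :
    augmentation F (Chains.single (F.restrict (punctured P)) σ s) =
      F.map (homOfLE (bot_le : ⊥ ≤ (σ.vertex 0 : P))).op s := by
  exact DirectSum.toModule_lof R (N := F.obj (op ⊥))
    (φ := fun σ : Simplex (punctured P) 0 =>
      (F.map (homOfLE (bot_le : ⊥ ≤ (σ.vertex 0 : P))).op).hom)
    (M := fun σ : Simplex (punctured P) 0 => (F.restrict (punctured P)).obj (op (σ.vertex 0))) σ s

theorem d_comp_augmentation (F : Sheaf.{u, v, w} R P) :
    (chainComplex (F.restrict (punctured P))).d 1 0 ≫ ModuleCat.ofHom (augmentation F) = 0 := by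
  ext1
  refine Chains.hom_ext _ fun σ s => ?_
  refine (congrArg (augmentation F) (chainComplex_d_single _ σ s)).trans ?_
  have key (i : Fin 2) : augmentation F (Chains.single (F.restrict (punctured P)) (σ.face i)
      ((F.restrict (punctured P)).map (homOfLE (σ.vertex_le (i.succAbove 0))).op s)) =
      F.map (homOfLE (bot_le : ⊥ ≤ (σ.vertex 0 : P))).op s := by
    refine (augmentation_single F _ _).trans ?_
    refine (ConcreteCategory.comp_apply _ _ _).symm.trans ?_
    refine congrArg (fun φ : F.obj (op (σ.vertex 0 : P)) ⟶ F.obj (op ⊥) => φ s) ?_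
    have h : (σ.vertex (i.succAbove 0) : P) ≤ (σ.vertex 0 : P) := σ.vertex_le (i.succAbove 0)
    exact (F.map_comp (homOfLE h).op (homOfLE bot_le).op).symm
  refine Eq.trans (b := (0 : F.obj (op ⊥))) ?_ rfl
  rw [map_sum, Fin.sum_univ_two, map_zsmul, map_zsmul, key, key]
  simp

/-- The augmented chain complex `S̃_*(P ∖ 0; F)`, with its degrees raised by one: the module in
degree `0` is `F(0)` and the module in degree `n + 1` is `S_n(P ∖ 0; F)`. -/
def augmentedComplex (F : Sheaf.{u, v, w} R P) : ChainComplex (ModuleCat.{max u w} R) ℕ :=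
  (chainComplex (F.restrict (punctured P))).augment (ModuleCat.ofHom (augmentation F))
    (d_comp_augmentation F)

/-- The reduced homology `H̃_i(P ∖ 0; F)`, for `i ≥ 0`, of a sheaf `F` on a poset `P` with
minimum `0`. -/
def reducedHomology (F : Sheaf.{u, v, w} R P) (i : ℕ) : ModuleCat.{max u w} R :=
  (augmentedComplex F).homology (i + 1)

/-- The restriction `Q ∖ 0 → P ∖ 0` of a poset map which sends no nonzero element to `0`. -/
def puncturedMap (f : Q →o P) (hf : ∀ x, x ≠ ⊥ → f x ≠ ⊥) : punctured Q →o punctured P where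
  toFun x := ⟨f x, hf x x.2⟩
  monotone' _ _ h := f.monotone h

/-- The chain map `S̃_*(Q ∖ 0; f^* F) → S̃_*(P ∖ 0; F)` which is `s_σ ↦ s_{f σ}` on the chains of
`Q ∖ 0` and the structure map `F(f 0) → F(0)` on the augmentation modules. -/
def augmentedComplexMap (F : Sheaf.{u, v, w} R P) (f : Q →o P) (hf : ∀ x, x ≠ ⊥ → f x ≠ ⊥) :
    augmentedComplex (F.pullback f) ⟶ augmentedComplex F where
  f
    | 0 => F.map (homOfLE (bot_le : ⊥ ≤ f ⊥)).op
    | n + 1 => (chainComplexMap (F.restrict (punctured P)) (puncturedMap f hf)).f n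
  comm' := by
    rintro i j rfl
    rcases j with _ | j
    · ext1
      refine Chains.hom_ext _ fun σ s => ?_
      refine (congrArg (augmentation F) (Chains.push_single (F.restrict (punctured P))
        (puncturedMap f hf) σ s)).trans ?_
      refine (augmentation_single F _ _).trans ?_
      refine Eq.trans ?_ (congrArg (F.map (homOfLE (bot_le : ⊥ ≤ f ⊥)).op)
        (augmentation_single (F.pullback f) σ s)).symm
      refine Eq.trans ?_ (ConcreteCategory.comp_apply _ _ _)
      refine congrArg (fun φ : F.obj (op (f (σ.vertex 0 : Q))) ⟶ F.obj (op ⊥) => φ s) ?_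
      exact F.map_comp (homOfLE _).op (homOfLE (bot_le : ⊥ ≤ f ⊥)).op
    · exact (chainComplexMap (F.restrict (punctured P)) (puncturedMap f hf)).comm (j + 1) j

/-- The map `H̃_i(Q ∖ 0; f^* F) → H̃_i(P ∖ 0; F)` induced by `s_σ ↦ s_{f σ}`. -/
def reducedHomologyMap (F : Sheaf.{u, v, w} R P) (f : Q →o P) (hf : ∀ x, x ≠ ⊥ → f x ≠ ⊥)
    (i : ℕ) : reducedHomology (F.pullback f) i ⟶ reducedHomology F i :=
  HomologicalComplex.homologyMap (augmentedComplexMap F f hf) (i + 1)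

/-- The cocone under the restriction of `F` to `P ∖ 0`, with vertex `F(0)` and with components the
structure maps `F(x) → F(0)`. -/
def augmentationCocone (F : Sheaf.{u, v, w} R P) :
    Limits.Cocone (F.restrict (punctured P)) where
  pt := F.obj (op ⊥)
  ι :=
    { app := fun x => F.map (homOfLE (bot_le : ⊥ ≤ (x.unop : P))).op
      naturality := fun x y φ => by
        refine Eq.trans ?_ (Category.comp_id _).symm
        exact (F.map_comp _ _).symm }

/-- The map `ε_* : colim_{P ∖ 0} F → F(0)` induced by the structure maps `F(x) → F(0)`. -/
def epsilonStar (F : Sheaf.{u, v, w} R P) :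
    Limits.colimit (F.restrict (punctured P)) ⟶ F.obj (op ⊥) :=
  Limits.colimit.desc _ (augmentationCocone F)

end Reduced

section Lattice

variable {L : Type u} [Lattice L] [OrderBot L]

/-- The deletion `L_a`: the elements of `L` that are joins of atoms different from `a`. -/
def deletion (a : L) : Set L :=
  {x | ∃ S : Set L, (∀ b ∈ S, IsAtom b ∧ b ≠ a) ∧ IsLUB S x}

instance (a : L) : OrderBot (deletion a) where
  bot := ⟨⊥, ∅, by simp, by simp⟩
  bot_le x := (bot_le : ⊥ ≤ (x : L))

/-- The restriction `L^a`: the interval of the elements of `L` above `a`, with minimum `a`. -/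
abbrev restriction (a : L) : Set L := Set.Ici a

/-- The inclusion `L_a → L`. -/
def deletionIncl (a : L) : deletion a →o L := OrderHom.Subtype.val (· ∈ deletion a)

theorem deletionIncl_ne_bot (a : L) (x : deletion a) (hx : x ≠ ⊥) : deletionIncl a x ≠ ⊥ :=
  fun h => hx (Subtype.ext h)

/-- The map `H̃_i(L_a ∖ 0; F) → H̃_i(L ∖ 0; F)` induced by the inclusion `L_a → L`. -/
def inclusionMap {R : Type v} [CommRing R] (F : Sheaf.{u, v, w} R L) (a : L) (i : ℕ) :
    reducedHomology (F.restrict (deletion a)) i ⟶ reducedHomology F i :=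
  reducedHomologyMap F (deletionIncl a) (deletionIncl_ne_bot a) i

end Lattice

end PosetSheaf

end

/-! Since `a` is an atom, a chain in `L ∖ 0` that meets `a` has `a` as its least vertex and so lies
in `L^a`. Thus every chain of `L ∖ 0` either avoids `a` or lies in `L^a`, and the chains doing both
are those of `L^a ∖ a`. Augmenting by `F(0)` for `L ∖ {0, a}` and `L ∖ 0`, and by `F(a)` for `L^a ∖
a` and `L^a`, gives a square of complexes that is bicartesian in every degree, hence a
Mayer–Vietoris sequence (`exists_longExact_of_square`).

Two corners simplify. The poset `L^a` has minimum `a`, so appending `a` to chains contracts its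
augmented complex in positive degrees (`coneComplex_exactAt`). The poset `L ∖ {0, a}` retracts onto
`L_a ∖ 0` by sending `x` to the join of the atoms below `x` other than `a` (`core`). This map lies
below the identity, so structure maps of `F` carry coefficients along it, and a prism homotopy makes
the retraction a homology isomorphism (`isIso_homologyMap_deletionTransfer`). Atomicity keeps the
join nonzero.

Surjectivity of `ε_*` says exactly that the augmented complex of `L^a ∖ a` is exact in degree `0`.
The connecting map into that degree therefore vanishes, which gives the surjection ending the
sequence.

All complexes are built from one sheaf on `L` and poset maps into `L` (`coneComplex`), so
coefficients can be compared between different posets. -/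

noncomputable section

namespace PosetSheaf

/-! ### Mayer–Vietoris for a degreewise bicartesian square of complexes -/

section Homological

open Limits

variable {R : Type v} [CommRing R] {A B C D E : ChainComplex (ModuleCat.{w} R) ℕ}

/-- A Mayer–Vietoris short exact sequence: `0 ⟶ C ⟶ A ⊞ D ⟶ B ⟶ 0` for a commutative square
which is bicartesian in every degree. -/
abbrev squareShortComplex (f : C ⟶ A) (g : C ⟶ D) (j : A ⟶ B) (k : D ⟶ B) (comm : f ≫ j = g ≫ k) :
    ShortComplex (ChainComplex (ModuleCat.{w} R) ℕ) :=
  ShortComplex.mk (biprod.lift f g) (biprod.desc j (-k)) (by simp [comm])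

/-- The sign on `k` makes the kernel of the second map the degreewise fibre product of `j` and `k`,
which `hex` identifies with the image of `C`. Injectivity of the single leg `g` suffices for the
first map to be mono. The identities `e1`–`e6` transfer the biproduct relations of complexes to
degree `n`. -/
theorem squareShortComplex_shortExact (f : C ⟶ A) (g : C ⟶ D) (j : A ⟶ B) (k : D ⟶ B)
    (comm : f ≫ j = g ≫ k) (hg : ∀ n, Function.Injective (g.f n))
    (hex : ∀ n (x : A.X n) (y : D.X n), j.f n x = k.f n y → ∃ w, f.f n w = x ∧ g.f n w = y)
    (hsurj : ∀ n (z : B.X n), ∃ x y, j.f n x + k.f n y = z) :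
    (squareShortComplex f g j k comm).ShortExact := by
  apply HomologicalComplex.shortExact_of_degreewise_shortExact
  intro n
  have e1 : (biprod.lift f g).f n ≫ (biprod.fst : A ⊞ D ⟶ A).f n = f.f n := by
    rw [← HomologicalComplex.comp_f, biprod.lift_fst]
  have e2 : (biprod.lift f g).f n ≫ (biprod.snd : A ⊞ D ⟶ D).f n = g.f n := by
    rw [← HomologicalComplex.comp_f, biprod.lift_snd]
  have e3 : (biprod.inl : A ⟶ A ⊞ D).f n ≫ (biprod.desc j (-k)).f n = j.f n := by
    rw [← HomologicalComplex.comp_f, biprod.inl_desc]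
  have e4 : (biprod.inr : D ⟶ A ⊞ D).f n ≫ (biprod.desc j (-k)).f n = -k.f n := by
    rw [← HomologicalComplex.comp_f, biprod.inr_desc]; rfl
  have e5 : (biprod.fst : A ⊞ D ⟶ A).f n ≫ (biprod.inl : A ⟶ A ⊞ D).f n +
      (biprod.snd : A ⊞ D ⟶ D).f n ≫ (biprod.inr : D ⟶ A ⊞ D).f n = 𝟙 _ := by
    rw [← HomologicalComplex.comp_f, ← HomologicalComplex.comp_f, ← HomologicalComplex.add_f_apply,
      biprod.total, HomologicalComplex.id_f]
  have e6 : (biprod.desc j (-k)).f n =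
      (biprod.fst : A ⊞ D ⟶ A).f n ≫ j.f n - (biprod.snd : A ⊞ D ⟶ D).f n ≫ k.f n := by
    rw [← e3, ← neg_eq_iff_eq_neg.mpr e4, Preadditive.comp_neg, sub_neg_eq_add,
      ← Category.assoc, ← Category.assoc, ← Preadditive.add_comp, e5, Category.id_comp]
  refine { exact := ?_, mono_f := ?_, epi_g := ?_ }
  · rw [ShortComplex.moduleCat_exact_iff]
    intro (x : (A ⊞ D).X n) (hx : (biprod.desc j (-k)).f n x = 0)
    rw [e6] at hx
    obtain ⟨w, h1, h2⟩ := hex n ((biprod.fst : A ⊞ D ⟶ A).f n x) ((biprod.snd : A ⊞ D ⟶ D).f n x)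
      (sub_eq_zero.mp hx)
    refine ⟨w, ?_⟩
    change (biprod.lift f g).f n w = x
    have h := congrArg (fun φ : (A ⊞ D).X n ⟶ (A ⊞ D).X n => φ x) e5
    have h' := congrArg (fun φ : (A ⊞ D).X n ⟶ (A ⊞ D).X n => φ ((biprod.lift f g).f n w)) e5
    have h3 := congrArg (fun φ : C.X n ⟶ A.X n => φ w) e1
    have h4 := congrArg (fun φ : C.X n ⟶ D.X n => φ w) e2
    simp only [ModuleCat.hom_add, ModuleCat.hom_comp, LinearMap.add_apply, LinearMap.comp_apply,
      ModuleCat.hom_id, LinearMap.id_apply] at h h' h3 h4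
    rw [← h', h3, h4, h1, h2]
    exact h
  · rw [ModuleCat.mono_iff_injective]
    change Function.Injective ((biprod.lift f g).f n)
    have := hg n
    rw [← e2] at this
    exact Function.Injective.of_comp (f := (biprod.snd : A ⊞ D ⟶ D).f n) (by
      simpa only [ModuleCat.hom_comp, LinearMap.coe_comp] using this)
  · rw [ModuleCat.epi_iff_surjective]
    intro z
    obtain ⟨x, y, h⟩ := hsurj n z
    refine ⟨(biprod.inl : A ⟶ A ⊞ D).f n x - (biprod.inr : D ⟶ A ⊞ D).f n y, ?_⟩
    change (biprod.desc j (-k)).f n _ = z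
    have h3 := congrArg (fun φ : A.X n ⟶ B.X n => φ x) e3
    have h4 := congrArg (fun φ : D.X n ⟶ B.X n => φ y) e4
    simp only [ModuleCat.hom_comp, LinearMap.comp_apply,
      ModuleCat.hom_neg, LinearMap.neg_apply] at h3 h4
    rw [map_sub, h3, h4, sub_neg_eq_add, h]

/-- The inverse is induced by `biprod.fst`: the other composite differs from the identity by a map
factoring through the zero module `D.homology n`. -/
theorem isIso_homologyMap_inl {n : ℕ} (hD : D.ExactAt n) :
    IsIso (HomologicalComplex.homologyMap (biprod.inl : A ⟶ A ⊞ D) n) := by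
  have hz : IsZero (D.homology n) := hD.isZero_homology
  refine ⟨HomologicalComplex.homologyMap biprod.fst n, ?_, ?_⟩
  · rw [← HomologicalComplex.homologyMap_comp, biprod.inl_fst, HomologicalComplex.homologyMap_id]
  · have h := congrArg (HomologicalComplex.homologyMap · n) (biprod.total (X := A) (Y := D))
    simp only [HomologicalComplex.homologyMap_add, HomologicalComplex.homologyMap_comp,
      HomologicalComplex.homologyMap_id] at h
    rw [hz.eq_of_tgt (HomologicalComplex.homologyMap (biprod.snd : A ⊞ D ⟶ D) n) 0,
      zero_comp, add_zero] at h
    exact h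

/-- The long exact homology sequence of a degreewise bicartesian square with an acyclic corner `D`
and a homology isomorphism `E ⟶ A`. -/
theorem exists_longExact_of_square (f : C ⟶ A) (g : C ⟶ D) (j : A ⟶ B) (k : D ⟶ B)
    (comm : f ≫ j = g ≫ k) (hg : ∀ n, Function.Injective (g.f n))
    (hex : ∀ n (x : A.X n) (y : D.X n), j.f n x = k.f n y → ∃ w, f.f n w = x ∧ g.f n w = y)
    (hsurj : ∀ n (z : B.X n), ∃ x y, j.f n x + k.f n y = z)
    (hD : ∀ n, D.ExactAt (n + 1)) (hC : C.ExactAt 0)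
    (ψ : E ⟶ A) (hψ : ∀ n, IsIso (HomologicalComplex.homologyMap ψ n)) :
    ∃ (α : ∀ i : ℕ, C.homology (i + 1) ⟶ E.homology (i + 1))
      (δ : ∀ i : ℕ, B.homology (i + 1 + 1) ⟶ C.homology (i + 1)),
      (∀ i, Function.Exact (α i) (HomologicalComplex.homologyMap (ψ ≫ j) (i + 1))) ∧
      (∀ i, Function.Exact (HomologicalComplex.homologyMap (ψ ≫ j) (i + 1 + 1)) (δ i)) ∧
      (∀ i, Function.Exact (δ i) (α i)) ∧
      Function.Surjective (HomologicalComplex.homologyMap (ψ ≫ j) (0 + 1)) := by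
  have hS := squareShortComplex_shortExact f g j k comm hg hex hsurj
  have hiso (n : ℕ) : IsIso (HomologicalComplex.homologyMap (ψ ≫ (biprod.inl : A ⟶ A ⊞ D))
      (n + 1)) := by
    have := isIso_homologyMap_inl (A := A) (hD n)
    have := hψ (n + 1)
    rw [HomologicalComplex.homologyMap_comp]
    infer_instance
  let e (n : ℕ) : E.homology (n + 1) ≅ (A ⊞ D).homology (n + 1) :=
    asIso (HomologicalComplex.homologyMap (ψ ≫ (biprod.inl : A ⟶ A ⊞ D)) (n + 1))
  -- Restricted to the summand `A`, the map `biprod.desc j (-k)` is `j`, so the sign does not reach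
  -- the map of interest.
  have he (n : ℕ) : HomologicalComplex.homologyMap (ψ ≫ j) (n + 1) = (e n).hom ≫
      HomologicalComplex.homologyMap (squareShortComplex f g j k comm).g (n + 1) := by
    dsimp only [e, asIso_hom]
    rw [← HomologicalComplex.homologyMap_comp]
    simp
  have he' (n : ℕ) (x : E.homology (n + 1)) : HomologicalComplex.homologyMap (ψ ≫ j) (n + 1) x =
      HomologicalComplex.homologyMap (squareShortComplex f g j k comm).g (n + 1)
        ((e n).hom x) := by
    rw [he]; rfl
  have hsurj_e (n : ℕ) : Function.Surjective (e n).hom :=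
    fun y => ⟨(e n).inv y, by rw [← ConcreteCategory.comp_apply, Iso.inv_hom_id]; rfl⟩
  have hinj_e (n : ℕ) : Function.Injective (e n).inv :=
    Function.LeftInverse.injective (g := (e n).hom)
      fun y => by rw [← ConcreteCategory.comp_apply, Iso.inv_hom_id]; rfl
  have hinj_e' (n : ℕ) : Function.Injective (e n).hom :=
    Function.LeftInverse.injective (g := (e n).inv)
      fun y => by rw [← ConcreteCategory.comp_apply, Iso.hom_inv_id]; rfl
  have h1 (n : ℕ) := (ShortComplex.ShortExact.moduleCat_exact_iff_function_exact _).mp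
    (hS.homology_exact₂ (n + 1))
  have h2 (n : ℕ) := (ShortComplex.ShortExact.moduleCat_exact_iff_function_exact _).mp
    (hS.homology_exact₃ (n + 1) n rfl)
  have h3 (n : ℕ) := (ShortComplex.ShortExact.moduleCat_exact_iff_function_exact _).mp
    (hS.homology_exact₁ (n + 1) n rfl)
  -- The middle term of the Mayer–Vietoris sequence is replaced by the homology of `E` through `e`.
  -- This is available only in positive degrees, where `D` is exact.
  refine ⟨fun i => HomologicalComplex.homologyMap (squareShortComplex f g j k comm).f (i + 1) ≫
    (e i).inv, fun i => hS.δ (i + 1 + 1) (i + 1) rfl, ?_, ?_, ?_, ?_⟩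
  · intro i y
    refine Iff.trans (Eq.congr_left (he' i y)) ((h1 i ((e i).hom y)).trans ⟨?_, ?_⟩)
    · rintro ⟨x, hx⟩
      refine ⟨x, hinj_e' i ?_⟩
      rw [← ConcreteCategory.comp_apply, Category.assoc, Iso.inv_hom_id, Category.comp_id]
      exact hx
    · rintro ⟨x, rfl⟩
      refine ⟨x, ?_⟩
      rw [← ConcreteCategory.comp_apply, Category.assoc, Iso.inv_hom_id, Category.comp_id]
  · intro i y
    refine (h2 (i + 1) y).trans ⟨?_, ?_⟩
    · rintro ⟨x, rfl⟩
      obtain ⟨z, rfl⟩ := hsurj_e (i + 1) x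
      exact ⟨z, he' _ _⟩
    · rintro ⟨x, rfl⟩
      exact ⟨_, (he' _ _).symm⟩
  · intro i y
    refine Iff.trans ?_ (h3 (i + 1) y)
    rw [ConcreteCategory.comp_apply]
    exact map_eq_zero_iff _ (hinj_e i)
  · intro z
    -- Exactness of `C` in degree `0` is used only here: it kills the connecting map out of degree
    -- `1`.
    have hz : hS.δ (0 + 1) 0 rfl = 0 := hC.isZero_homology.eq_of_tgt _ _
    obtain ⟨x, rfl⟩ := (h2 0 z).mp
      (congrArg (fun φ : B.homology (0 + 1) ⟶ C.homology 0 => φ z) hz)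
    obtain ⟨y, rfl⟩ := hsurj_e 0 x
    exact ⟨y, he' _ _⟩

end Homological

/-! ### Functoriality of augmented chains under maps that lower the coefficients -/

section Transfer

variable {R : Type v} [CommRing R] {P Q Q' Q'' : Type u} [PartialOrder P] [PartialOrder Q]
  [PartialOrder Q'] [PartialOrder Q'']

theorem Sheaf.map_map (F : Sheaf.{u, v, w} R P) {x y z : P} (h : x ≤ y) (h' : y ≤ z)
    (s : F.obj (op z)) :
    F.map (homOfLE h).op (F.map (homOfLE h').op s) = F.map (homOfLE (h.trans h')).op s := by
  rw [← ConcreteCategory.comp_apply, ← F.map_comp]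
  rfl

theorem Sheaf.map_self (F : Sheaf.{u, v, w} R P) {x : P} (h : x ≤ x) (s : F.obj (op x)) :
    F.map (homOfLE h).op s = s :=
  congrArg (fun φ : F.obj (op x) ⟶ F.obj (op x) => φ s) (F.map_id _)

/-- Equal simplices have coefficient modules that are only propositionally equal. Writing both
coefficients as images of one `s ∈ F(y)` avoids a transport. -/
theorem Chains.single_map_congr (F : Sheaf.{u, v, w} R P) (f : Q →o P) {n : ℕ} {σ τ : Simplex Q n}
    (h : σ = τ) {y : P} (hσ : f (σ.vertex 0) ≤ y) (s : F.obj (op y)) :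
    Chains.single (F.pullback f) σ (F.map (homOfLE hσ).op s) =
      Chains.single (F.pullback f) τ (F.map (homOfLE (h ▸ hσ : f (τ.vertex 0) ≤ y)).op s) := by
  subst h; rfl

/-- The map of chains `s_σ ↦ F(f(u x₀) ≤ f'(x₀))(s)_{u σ}` associated with a poset map
`u : Q' → Q` such that `f ∘ u ≤ f'`. -/
def Chains.transfer (F : Sheaf.{u, v, w} R P) (f' : Q' →o P) (f : Q →o P) (u : Q' →o Q)
    (h : ∀ x, f (u x) ≤ f' x) (n : ℕ) :
    Chains (F.pullback f') n →ₗ[R] Chains (F.pullback f) n :=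
  DirectSum.toModule R _ _ fun σ => (Chains.single (F.pullback f) (σ.map u)).comp
    (F.map (homOfLE (h (σ.vertex 0))).op).hom

@[simp]
theorem Chains.transfer_single (F : Sheaf.{u, v, w} R P) (f' : Q' →o P) (f : Q →o P) (u : Q' →o Q)
    (h : ∀ x, f (u x) ≤ f' x) {n : ℕ} (σ : Simplex Q' n) (s : F.obj (op (f' (σ.vertex 0)))) :
    Chains.transfer F f' f u h n (Chains.single (F.pullback f') σ s) =
      Chains.single (F.pullback f) (σ.map u) (F.map (homOfLE (h (σ.vertex 0))).op s) := by
  refine (DirectSum.toModule_lof R (M := fun σ : Simplex Q' n =>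
    (F.pullback f').obj (op (σ.vertex 0))) σ s).trans ?_
  rfl

theorem Chains.pull_pullback_single (F : Sheaf.{u, v, w} R P) (f : Q →o P) {m n : ℕ}
    (θ : Fin (m + 1) →o Fin (n + 1)) (σ : Simplex Q n) (s : F.obj (op (f (σ.vertex 0)))) :
    Chains.pull (F.pullback f) θ (Chains.single (F.pullback f) σ s) =
      Chains.single (F.pullback f) (σ.comp θ)
        (F.map (homOfLE (f.monotone (σ.vertex_le (θ 0)))).op s) :=
  Chains.pull_single (F.pullback f) θ σ s

/-- `Chains.transfer` as a simplicial map. -/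
def simplicialTransfer (F : Sheaf.{u, v, w} R P) (f' : Q' →o P) (f : Q →o P) (u : Q' →o Q)
    (h : ∀ x, f (u x) ≤ f' x) :
    simplicialChains (F.pullback f') ⟶ simplicialChains (F.pullback f) where
  app n := ModuleCat.ofHom (Chains.transfer F f' f u h n.unop.len)
  naturality n m θ := by
    ext1
    refine Chains.hom_ext _ fun σ s => ?_
    refine (congrArg (Chains.transfer F f' f u h _)
      (Chains.pull_pullback_single F f' _ σ s)).trans ?_
    refine Eq.trans ?_ (congrArg (Chains.pull _ _) (Chains.transfer_single F f' f u h σ s)).symm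
    refine (Chains.transfer_single F f' f u h _ _).trans ?_
    refine Eq.trans ?_ (Chains.pull_pullback_single F f _ _ _).symm
    refine congrArg (Chains.single (F.pullback f)
      (Simplex.map u (σ.comp θ.unop.toOrderHom))) ?_
    exact (F.map_map _ _ s).trans (F.map_map (f.monotone ((σ.map u).vertex_le _)) _ s).symm

/-- The augmentation `S_0(Q; f^* F) → F(m)`, for a lower bound `m` of the image of `f`. -/
def coneAugmentation (F : Sheaf.{u, v, w} R P) (f : Q →o P) (m : P) (hm : ∀ x, m ≤ f x) :
    Chains (F.pullback f) 0 →ₗ[R] F.obj (op m) :=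
  DirectSum.toModule R _ _ fun σ => (F.map (homOfLE (hm (σ.vertex 0))).op).hom

@[simp]
theorem coneAugmentation_single (F : Sheaf.{u, v, w} R P) (f : Q →o P) (m : P)
    (hm : ∀ x, m ≤ f x) (σ : Simplex Q 0) (s : F.obj (op (f (σ.vertex 0)))) :
    coneAugmentation F f m hm (Chains.single (F.pullback f) σ s) =
      F.map (homOfLE (hm (σ.vertex 0))).op s :=
  DirectSum.toModule_lof R (N := F.obj (op m))
    (φ := fun σ : Simplex Q 0 => (F.map (homOfLE (hm (σ.vertex 0))).op).hom)
    (M := fun σ : Simplex Q 0 => (F.pullback f).obj (op (σ.vertex 0))) σ s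

theorem d_comp_coneAugmentation (F : Sheaf.{u, v, w} R P) (f : Q →o P) (m : P)
    (hm : ∀ x, m ≤ f x) :
    (chainComplex (F.pullback f)).d 1 0 ≫ ModuleCat.ofHom (coneAugmentation F f m hm) = 0 := by
  ext1
  refine Chains.hom_ext _ fun σ s => ?_
  refine (congrArg (coneAugmentation F f m hm) (chainComplex_d_single _ σ s)).trans ?_
  have key (i : Fin 2) : coneAugmentation F f m hm (Chains.single (F.pullback f) (σ.face i)
      ((F.pullback f).map (homOfLE (σ.vertex_le (i.succAbove 0))).op s)) =
      F.map (homOfLE (hm (σ.vertex 0))).op s := by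
    refine (coneAugmentation_single F _ _ _ _ _).trans ?_
    exact F.map_map _ (f.monotone (σ.vertex_le (i.succAbove 0))) s
  refine Eq.trans (b := (0 : F.obj (op m))) ?_ rfl
  rw [map_sum, Fin.sum_univ_two, map_zsmul, map_zsmul, key, key]
  simp

/-- The complex `S_*(Q; f^* F)` augmented by `F(m)`, for a lower bound `m` of the image of `f`. -/
def coneComplex (F : Sheaf.{u, v, w} R P) (f : Q →o P) (m : P) (hm : ∀ x, m ≤ f x) :
    ChainComplex (ModuleCat.{max u w} R) ℕ :=
  (chainComplex (F.pullback f)).augment (ModuleCat.ofHom (coneAugmentation F f m hm))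
    (d_comp_coneAugmentation F f m hm)

/-- The chain map of augmented complexes induced by `Chains.transfer`. -/
def coneTransfer (F : Sheaf.{u, v, w} R P) {f' : Q' →o P} {f : Q →o P} {m' m : P}
    (hm' : ∀ x, m' ≤ f' x) (hm : ∀ x, m ≤ f x) (u : Q' →o Q) (h : ∀ x, f (u x) ≤ f' x)
    (hmm : m ≤ m') : coneComplex F f' m' hm' ⟶ coneComplex F f m hm where
  f
    | 0 => F.map (homOfLE hmm).op
    | n + 1 => ((AlgebraicTopology.alternatingFaceMapComplex (ModuleCat.{max u w} R)).map
        (simplicialTransfer F f' f u h)).f n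
  comm' := by
    rintro i j rfl
    rcases j with _ | j
    · ext1
      refine Chains.hom_ext _ fun σ s => ?_
      refine (congrArg (coneAugmentation F f m hm) (Chains.transfer_single F f' f u h σ s)).trans ?_
      refine (coneAugmentation_single F f m hm _ _).trans ?_
      refine Eq.trans ?_ (congrArg (F.map (homOfLE hmm).op)
        (coneAugmentation_single F f' m' hm' σ s)).symm
      exact (F.map_map (hm _) _ s).trans (F.map_map _ _ s).symm
    · exact ((AlgebraicTopology.alternatingFaceMapComplex (ModuleCat.{max u w} R)).map
        (simplicialTransfer F f' f u h)).comm (j + 1) j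

theorem coneTransfer_comp (F : Sheaf.{u, v, w} R P) {f'' : Q'' →o P} {f' : Q' →o P} {f : Q →o P}
    {m'' m' m : P} (hm'' : ∀ x, m'' ≤ f'' x) (hm' : ∀ x, m' ≤ f' x) (hm : ∀ x, m ≤ f x)
    (u' : Q'' →o Q') (u : Q' →o Q) (h' : ∀ x, f' (u' x) ≤ f'' x) (h : ∀ x, f (u x) ≤ f' x)
    (hmm' : m' ≤ m'') (hmm : m ≤ m') :
    coneTransfer F hm'' hm' u' h' hmm' ≫ coneTransfer F hm' hm u h hmm =
      coneTransfer F hm'' hm (u.comp u') (fun x => (h _).trans (h' x)) (hmm.trans hmm') := by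
  ext1 n
  rcases n with _ | n
  · exact (F.map_comp (homOfLE hmm').op (homOfLE hmm).op).symm
  · ext1
    refine Chains.hom_ext _ fun σ s => ?_
    refine (congrArg (Chains.transfer F f' f u h n)
      (Chains.transfer_single F f'' f' u' h' σ s)).trans ?_
    refine (Chains.transfer_single F f' f u h _ _).trans ?_
    refine Eq.trans ?_ (Chains.transfer_single F f'' f (u.comp u')
      (fun x => (h _).trans (h' x)) σ s).symm
    exact congrArg (Chains.single (F.pullback f) (σ.map (u.comp u'))) (F.map_map _ _ s)

theorem coneTransfer_id (F : Sheaf.{u, v, w} R P) {f : Q →o P} {m : P} (hm : ∀ x, m ≤ f x)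
    (u : Q →o Q) (hu : u = OrderHom.id) (h : ∀ x, f (u x) ≤ f x) (hmm : m ≤ m) :
    coneTransfer F hm hm u h hmm = 𝟙 _ := by
  subst hu
  ext1 n
  rcases n with _ | n
  · exact F.map_id _
  · ext1
    refine Chains.hom_ext _ fun σ s => ?_
    refine (Chains.transfer_single F f f _ h σ s).trans ?_
    exact congrArg (Chains.single (F.pullback f) σ) (F.map_self _ s)

end Transfer

/-! ### The prism homotopy for a poset map below the identity -/

section Prism

variable {R : Type v} [CommRing R] {P Q : Type u} [PartialOrder P] [PartialOrder Q]

/-- The linear map `s_σ ↦ F(f(x') ≤ f(x₀))(s)_{Φ σ}` associated with a map `Φ` of simplices which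
does not increase the vertex number `0`. -/
def Chains.reshape (F : Sheaf.{u, v, w} R P) (f : Q →o P) {n m : ℕ}
    (Φ : Simplex Q n → Simplex Q m) (h : ∀ σ, (Φ σ).vertex 0 ≤ σ.vertex 0) :
    Chains (F.pullback f) n →ₗ[R] Chains (F.pullback f) m :=
  DirectSum.toModule R _ _ fun σ => (Chains.single (F.pullback f) (Φ σ)).comp
    (F.map (homOfLE (f.monotone (h σ))).op).hom

theorem Chains.reshape_single (F : Sheaf.{u, v, w} R P) (f : Q →o P) {n m : ℕ}
    (Φ : Simplex Q n → Simplex Q m) (h : ∀ σ, (Φ σ).vertex 0 ≤ σ.vertex 0) (σ : Simplex Q n)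
    (s : F.obj (op (f (σ.vertex 0)))) :
    Chains.reshape F f Φ h (Chains.single (F.pullback f) σ s) =
      Chains.single (F.pullback f) (Φ σ) (F.map (homOfLE (f.monotone (h σ))).op s) := by
  refine (DirectSum.toModule_lof R (M := fun σ : Simplex Q n =>
    (F.pullback f).obj (op (σ.vertex 0))) σ s).trans ?_
  rfl

theorem Chains.reshape_comp (F : Sheaf.{u, v, w} R P) (f : Q →o P) {n m l : ℕ}
    (Φ : Simplex Q n → Simplex Q m) (h : ∀ σ, (Φ σ).vertex 0 ≤ σ.vertex 0)
    (Ψ : Simplex Q m → Simplex Q l) (h' : ∀ σ, (Ψ σ).vertex 0 ≤ σ.vertex 0) :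
    (Chains.reshape F f Ψ h').comp (Chains.reshape F f Φ h) =
      Chains.reshape F f (Ψ ∘ Φ) (fun σ => (h' _).trans (h σ)) := by
  refine Chains.hom_ext _ fun σ s => ?_
  refine (congrArg (Chains.reshape F f Ψ h') (Chains.reshape_single F f Φ h σ s)).trans ?_
  refine (Chains.reshape_single F f Ψ h' _ _).trans ?_
  refine Eq.trans ?_ (Chains.reshape_single F f (Ψ ∘ Φ) (fun σ => (h' _).trans (h σ)) σ s).symm
  exact congrArg (Chains.single (F.pullback f) (Ψ (Φ σ))) (F.map_map _ (f.monotone (h σ)) s)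

theorem Chains.reshape_congr (F : Sheaf.{u, v, w} R P) (f : Q →o P) {n m : ℕ}
    {Φ Ψ : Simplex Q n → Simplex Q m} (e : Φ = Ψ) (h : ∀ σ, (Φ σ).vertex 0 ≤ σ.vertex 0)
    (h' : ∀ σ, (Ψ σ).vertex 0 ≤ σ.vertex 0) :
    Chains.reshape F f Φ h = Chains.reshape F f Ψ h' := by
  subst e; rfl

theorem Chains.reshape_id (F : Sheaf.{u, v, w} R P) (f : Q →o P) {n : ℕ}
    (h : ∀ σ : Simplex Q n, (id σ).vertex 0 ≤ σ.vertex 0) :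
    Chains.reshape F f id h = LinearMap.id := by
  refine Chains.hom_ext _ fun σ s => ?_
  refine (Chains.reshape_single F f id h σ s).trans ?_
  exact congrArg (Chains.single (F.pullback f) σ) (F.map_self _ s)

/-- The simplex `u x_n ≤ ⋯ ≤ u x_i ≤ x_i ≤ ⋯ ≤ x_0`. -/
def Simplex.prism (u : Q →o Q) (hu : ∀ x, u x ≤ x) {n : ℕ} (i : Fin (n + 1)) (σ : Simplex Q n) :
    Simplex Q (n + 1) where
  toFun k := if k ≤ i.castSucc then σ (i.predAbove k) else u.dual (σ (i.predAbove k))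
  monotone' k l hkl := by
    have h : σ (i.predAbove k) ≤ σ (i.predAbove l) := σ.monotone (Fin.predAbove_right_monotone i hkl)
    dsimp only
    split_ifs with h1 h2 h2
    · exact h
    · exact h.trans (hu (OrderDual.ofDual (σ (i.predAbove l))))
    · exact absurd (hkl.trans h2) h1
    · exact u.dual.monotone h

theorem Simplex.prism_vertex_zero_le (u : Q →o Q) (hu : ∀ x, u x ≤ x) {n : ℕ} (i : Fin (n + 1))
    (σ : Simplex Q n) : (σ.prism u hu i).vertex 0 ≤ σ.vertex 0 :=
  Simplex.vertex_le σ _ |>.trans' (by simp [Simplex.vertex, Simplex.prism]; exact le_rfl)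

theorem ite_apply_congr {α β : Type*} (σ : α → β) (v : β → β) {p q : Prop} [Decidable p]
    [Decidable q] {k l : α} (h : p ↔ q) (hkl : k = l) :
    (if p then σ k else v (σ k)) = if q then σ l else v (σ l) := by
  subst hkl; simp only [h]

/-- With `predAbove_val`, this turns the simplicial identities of the prisms into linear arithmetic.
-/
theorem succAbove_val {n : ℕ} (i : Fin (n + 1)) (k : Fin n) :
    (i.succAbove k : ℕ) = if (k : ℕ) < i then (k : ℕ) else k + 1 := by
  simp only [Fin.succAbove, Fin.lt_def, Fin.val_castSucc]
  split_ifs <;> simp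

theorem predAbove_val {n : ℕ} (j : Fin n) (k : Fin (n + 1)) :
    (j.predAbove k : ℕ) = if (j : ℕ) < k then (k : ℕ) - 1 else k := by
  simp only [Fin.predAbove, Fin.lt_def, Fin.val_castSucc]
  split_ifs <;> simp

/-- The operation on simplices given by a monotone map. -/
def Simplex.pull {m n : ℕ} (θ : Fin (m + 1) →o Fin (n + 1)) (σ : Simplex Q n) : Simplex Q m :=
  σ.comp θ

theorem Simplex.pull_vertex_zero_le {m n : ℕ} (θ : Fin (m + 1) →o Fin (n + 1)) (σ : Simplex Q n) :
    (σ.pull θ).vertex 0 ≤ σ.vertex 0 :=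
  σ.vertex_le (θ 0)

/-- Functoriality of `F` leaves no choice of coefficient map once the simplices agree, so an
identity of operators reduces to one of simplices. -/
theorem Chains.reshape_comp_congr (F : Sheaf.{u, v, w} R P) (f : Q →o P) {n m m' l : ℕ}
    {Φ : Simplex Q n → Simplex Q m} {h : ∀ σ, (Φ σ).vertex 0 ≤ σ.vertex 0}
    {Ψ : Simplex Q m → Simplex Q l} {h' : ∀ σ, (Ψ σ).vertex 0 ≤ σ.vertex 0}
    {Φ' : Simplex Q n → Simplex Q m'} {k : ∀ σ, (Φ' σ).vertex 0 ≤ σ.vertex 0}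
    {Ψ' : Simplex Q m' → Simplex Q l} {k' : ∀ σ, (Ψ' σ).vertex 0 ≤ σ.vertex 0}
    (e : ∀ σ, Ψ (Φ σ) = Ψ' (Φ' σ)) :
    ModuleCat.ofHom (Chains.reshape F f Φ h) ≫ ModuleCat.ofHom (Chains.reshape F f Ψ h') =
      ModuleCat.ofHom (Chains.reshape F f Φ' k) ≫ ModuleCat.ofHom (Chains.reshape F f Ψ' k') := by
  rw [← ModuleCat.ofHom_comp, ← ModuleCat.ofHom_comp, Chains.reshape_comp, Chains.reshape_comp]
  exact congrArg ModuleCat.ofHom (Chains.reshape_congr F f (funext e) _ _)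

open Simplicial in
/-- The component of the prism homotopy. -/
def prismMap (F : Sheaf.{u, v, w} R P) (f : Q →o P) (u : Q →o Q) (hu : ∀ x, u x ≤ x) {n : ℕ}
    (i : Fin (n + 1)) : (simplicialChains (F.pullback f)).obj (op ⦋n⦌) ⟶
      (simplicialChains (F.pullback f)).obj (op ⦋n + 1⦌) :=
  ModuleCat.ofHom (Chains.reshape F f (Simplex.prism u hu i) (Simplex.prism_vertex_zero_le u hu i))

-- A prism is determined by the cut after `i`, beyond which `u` is applied, and by the index map
-- `i.predAbove`. Commutation with a simplicial operator amounts to compatibility with these two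
-- data, expressed by `h` and `h'`.
open Simplicial in
theorem prismMap_comp_map (F : Sheaf.{u, v, w} R P) (f : Q →o P) (u : Q →o Q) (hu : ∀ x, u x ≤ x)
    {n m : ℕ} {i : Fin (n + 1)} {i' : Fin (m + 1)} {θ : ⦋m + 1⦌ ⟶ ⦋n + 1⦌} {θ' : ⦋m⦌ ⟶ ⦋n⦌}
    (h : ∀ k : Fin (m + 2), (θ.toOrderHom k : Fin (n + 2)) ≤ i.castSucc ↔ k ≤ i'.castSucc)
    (h' : ∀ k : Fin (m + 2), i.predAbove (θ.toOrderHom k) = θ'.toOrderHom (i'.predAbove k)) :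
    prismMap F f u hu i ≫ (simplicialChains (F.pullback f)).map θ.op =
      (simplicialChains (F.pullback f)).map θ'.op ≫ prismMap F f u hu i' :=
  Chains.reshape_comp_congr F f (Φ := Simplex.prism u hu i) (Ψ := Simplex.pull θ.toOrderHom)
    (Φ' := Simplex.pull θ'.toOrderHom) (Ψ' := Simplex.prism u hu i')
    (h := Simplex.prism_vertex_zero_le u hu i) (h' := Simplex.pull_vertex_zero_le _)
    (k := Simplex.pull_vertex_zero_le _) (k' := Simplex.prism_vertex_zero_le u hu i') fun σ =>
    OrderHom.ext _ _ (funext fun k => ite_apply_congr σ u.dual (h k) (h' k))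

-- This serves the face shared by two consecutive prisms: they differ only at one vertex, and the
-- operator omits it.
open Simplicial in
theorem prismMap_comp_map_eq (F : Sheaf.{u, v, w} R P) (f : Q →o P) (u : Q →o Q)
    (hu : ∀ x, u x ≤ x) {n m : ℕ} {i i' : Fin (n + 1)} {θ : ⦋m⦌ ⟶ ⦋n + 1⦌}
    (h : ∀ k : Fin (m + 1), (θ.toOrderHom k : Fin (n + 2)) ≤ i.castSucc ↔
      (θ.toOrderHom k : Fin (n + 2)) ≤ i'.castSucc)
    (h' : ∀ k : Fin (m + 1), i.predAbove (θ.toOrderHom k) = i'.predAbove (θ.toOrderHom k)) :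
    prismMap F f u hu i ≫ (simplicialChains (F.pullback f)).map θ.op =
      prismMap F f u hu i' ≫ (simplicialChains (F.pullback f)).map θ.op :=
  Chains.reshape_comp_congr F f (Φ := Simplex.prism u hu i) (Ψ := Simplex.pull θ.toOrderHom)
    (Φ' := Simplex.prism u hu i') (Ψ' := Simplex.pull θ.toOrderHom)
    (h := Simplex.prism_vertex_zero_le u hu i) (h' := Simplex.pull_vertex_zero_le _)
    (k := Simplex.prism_vertex_zero_le u hu i') (k' := Simplex.pull_vertex_zero_le _) fun σ =>
    OrderHom.ext _ _ (funext fun k => ite_apply_congr σ u.dual (h k) (h' k))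

set_option linter.unusedSimpArgs false in
/-- The prism homotopy between the identity and the map induced by `u ≤ id`. -/
def prismHomotopy (F : Sheaf.{u, v, w} R P) (f : Q →o P) (u : Q →o Q) (hu : ∀ x, u x ≤ x) :
    SimplicialObject.Homotopy (𝟙 (simplicialChains (F.pullback f)))
      (simplicialTransfer F f f u fun x => f.monotone (hu x)) where
  h i := prismMap F f u hu i
  h_zero_comp_δ_zero n := by
    refine (congrArg ModuleCat.ofHom (Chains.reshape_comp F f _ (Simplex.prism_vertex_zero_le u hu 0)
      _ (Simplex.pull_vertex_zero_le (SimplexCategory.δ 0).toOrderHom))).trans ?_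
    refine congrArg ModuleCat.ofHom (Chains.reshape_congr F f (Ψ := Simplex.map u) (funext fun σ =>
      OrderHom.ext _ _ (funext fun k => ?_)) _ fun σ => hu _)
    -- In `u x_n ≤ ⋯ ≤ u x_0 ≤ x_0` the face `0` drops the only vertex to which `u` is not applied,
    -- leaving `u σ`.
    change (if Fin.succAbove 0 k ≤ Fin.castSucc 0 then σ (Fin.predAbove 0 (Fin.succAbove 0 k)) else
      u.dual (σ (Fin.predAbove 0 (Fin.succAbove 0 k)))) = _
    rw [if_neg (by simp)]
    exact congrArg (fun k => u.dual (σ k)) (Fin.predAbove_zero_succ (i := k))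
  h_last_comp_δ_last n := by
    refine (congrArg ModuleCat.ofHom (Chains.reshape_comp F f _
      (Simplex.prism_vertex_zero_le u hu (Fin.last n)) _
      (Simplex.pull_vertex_zero_le (SimplexCategory.δ (Fin.last (n + 1))).toOrderHom))).trans ?_
    refine Eq.trans (congrArg ModuleCat.ofHom (Chains.reshape_congr F f (Ψ := id) (funext fun σ =>
      OrderHom.ext _ _ (funext fun k => ?_)) _ fun σ => le_rfl)) ?_
    -- In `u x_n ≤ x_n ≤ ⋯ ≤ x_0` the last face drops `u x_n`, leaving `σ`.
    · change (if Fin.succAbove (Fin.last (n + 1)) k ≤ Fin.castSucc (Fin.last n) then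
        σ ((Fin.last n).predAbove ((Fin.last (n + 1)).succAbove k)) else _) = _
      rw [if_pos (by simp [Fin.le_def]; omega)]
      refine congrArg σ (Fin.ext ?_)
      rw [predAbove_val, succAbove_val]
      simp only [Fin.val_last]
      split_ifs <;> omega
    · rw [Chains.reshape_id]; rfl
  h_succ_comp_δ_castSucc_of_lt {n} i j hij := by
    refine prismMap_comp_map F f u hu (fun k => ?_) fun k => ?_
    · change i.castSucc.succAbove k ≤ j.succ.castSucc ↔ k ≤ j.castSucc
      simp only [Fin.le_def, succAbove_val, Fin.val_castSucc,
        Fin.val_succ] at hij ⊢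
      split_ifs <;> omega
    · change j.succ.predAbove (i.castSucc.succAbove k) = i.succAbove (j.predAbove k)
      simp only [Fin.le_def, Fin.ext_iff, succAbove_val, predAbove_val,
        Fin.val_castSucc, Fin.val_succ] at hij ⊢
      split_ifs <;> omega
  h_succ_comp_δ_castSucc_succ {n} j := by
    refine prismMap_comp_map_eq F f u hu (fun k => ?_) fun k => ?_
    · change j.castSucc.succ.succAbove k ≤ j.succ.castSucc ↔
        j.castSucc.succ.succAbove k ≤ j.castSucc.castSucc
      simp only [Fin.le_def, succAbove_val, Fin.val_castSucc, Fin.val_succ]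
      split_ifs <;> omega
    · change j.succ.predAbove (j.castSucc.succ.succAbove k) =
        j.castSucc.predAbove (j.castSucc.succ.succAbove k)
      simp only [Fin.ext_iff, succAbove_val, predAbove_val, Fin.val_castSucc, Fin.val_succ]
      split_ifs <;> omega
  h_castSucc_comp_δ_succ_of_lt {n} i j hji := by
    refine prismMap_comp_map F f u hu (fun k => ?_) fun k => ?_
    · change i.succ.succAbove k ≤ j.castSucc.castSucc ↔ k ≤ j.castSucc
      simp only [Fin.le_def, Fin.lt_def, succAbove_val, Fin.val_castSucc,
        Fin.val_succ] at hji ⊢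
      split_ifs <;> omega
    · change j.castSucc.predAbove (i.succ.succAbove k) = i.succAbove (j.predAbove k)
      simp only [Fin.lt_def, Fin.ext_iff, succAbove_val, predAbove_val,
        Fin.val_castSucc, Fin.val_succ] at hji ⊢
      split_ifs <;> omega
  h_comp_σ_castSucc_of_le {n} i j hij := by
    refine prismMap_comp_map F f u hu (fun k => ?_) fun k => ?_
    · change i.castSucc.predAbove k ≤ j.castSucc ↔ k ≤ j.succ.castSucc
      simp only [Fin.le_def, predAbove_val, Fin.val_castSucc,
        Fin.val_succ] at hij ⊢
      split_ifs <;> omega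
    · change j.predAbove (i.castSucc.predAbove k) = i.predAbove (j.succ.predAbove k)
      simp only [Fin.le_def, Fin.ext_iff, predAbove_val,
        Fin.val_castSucc, Fin.val_succ] at hij ⊢
      split_ifs <;> omega
  h_comp_σ_succ_of_lt {n} i j hji := by
    refine prismMap_comp_map F f u hu (fun k => ?_) fun k => ?_
    · change i.succ.predAbove k ≤ j.castSucc ↔ k ≤ j.castSucc.castSucc
      simp only [Fin.le_def, predAbove_val, Fin.val_castSucc,
        Fin.val_succ] at hji ⊢
      split_ifs <;> omega
    · change j.predAbove (i.succ.predAbove k) = i.predAbove (j.castSucc.predAbove k)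
      simp only [Fin.le_def, Fin.ext_iff, predAbove_val,
        Fin.val_castSucc, Fin.val_succ] at hji ⊢
      split_ifs <;> omega

end Prism

/-! ### Extending the prism homotopy to augmented complexes -/

section ConeHomotopy

variable {R : Type v} [CommRing R] {P Q : Type u} [PartialOrder P] [PartialOrder Q]

/-- The components of `coneHomotopy`. -/
def coneHomotopyHom (F : Sheaf.{u, v, w} R P) {f : Q →o P} {m : P} (hm : ∀ x, m ≤ f x)
    (u : Q →o Q) (hu : ∀ x, u x ≤ x) :
    ∀ i j : ℕ, (coneComplex F f m hm).X i ⟶ (coneComplex F f m hm).X j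
  | i + 1, j + 1 => (prismHomotopy F f u hu).toChainHomotopy.hom i j
  | 0, _ => 0
  | _ + 1, 0 => 0

/-- The map of augmented complexes induced by a poset map `u ≤ id` is homotopic to the identity. -/
def coneHomotopy (F : Sheaf.{u, v, w} R P) {f : Q →o P} {m : P} (hm : ∀ x, m ≤ f x)
    (u : Q →o Q) (hu : ∀ x, u x ≤ x) :
    Homotopy (𝟙 (coneComplex F f m hm))
      (coneTransfer F hm hm u (fun x => f.monotone (hu x)) le_rfl) where
  hom := coneHomotopyHom F hm u hu
  zero i j hij := by
    rcases i with _ | i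
    · rfl
    · rcases j with _ | j
      · rfl
      · exact (prismHomotopy F f u hu).toChainHomotopy.zero i j fun h => hij (congrArg (· + 1) h)
  comm i := by
    have H := (prismHomotopy F f u hu).toChainHomotopy.comm
    rcases i with _ | _ | i
    -- On the augmentation module both maps are the identity of `F(m)`, so the homotopy can be zero
    -- there.
    · rw [dNext_eq_zero _ _ (by simp), prevD_eq (j' := 1) (w := by simp),
        show coneHomotopyHom F hm u hu 0 1 = 0 from rfl, Limits.zero_comp, zero_add, zero_add]
      exact (F.map_id _).symm
    -- The term through `F(m)` vanishes, leaving the degree `0` identity of the unaugmented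
    -- homotopy.
    · rw [dNext_eq (i' := 0) (w := by simp), prevD_eq (j' := 2) (w := by simp),
        show coneHomotopyHom F hm u hu 0 (0 + 1) = 0 from rfl, Limits.comp_zero]
      have := H 0
      rw [dNext_eq_zero _ _ (by simp), prevD_eq (j' := 1) (w := by simp)] at this
      exact this
    · rw [dNext_eq (i' := i + 1) (w := by simp), prevD_eq (j' := i + 3) (w := by simp)]
      have := H (i + 1)
      rw [dNext_eq (i' := i) (w := by simp), prevD_eq (j' := i + 2) (w := by simp)] at this
      exact this

theorem homologyMap_coneTransfer_of_le (F : Sheaf.{u, v, w} R P) {f : Q →o P} {m : P}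
    (hm : ∀ x, m ≤ f x) (u : Q →o Q) (hu : ∀ x, u x ≤ x) (h : ∀ x, f (u x) ≤ f x) (hmm : m ≤ m)
    (n : ℕ) : HomologicalComplex.homologyMap (coneTransfer F hm hm u h hmm) n = 𝟙 _ := by
  rw [← (coneHomotopy F hm u hu).homologyMap_eq n, HomologicalComplex.homologyMap_id]

end ConeHomotopy

/-! ### Acyclicity of a poset with minimum -/

section Contraction

variable {R : Type v} [CommRing R] {P Q : Type u} [PartialOrder P] [PartialOrder Q]

/-- The differential of `S_*(Q; f^* F)` as an alternating sum of faces. -/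
def Chains.boundary (F : Sheaf.{u, v, w} R P) (f : Q →o P) (n : ℕ) :
    Chains (F.pullback f) (n + 1) →ₗ[R] Chains (F.pullback f) n :=
  ∑ i : Fin (n + 2), (-1 : ℤ) ^ (i : ℕ) •
    Chains.reshape F f (Simplex.pull (Fin.succAboveOrderEmb i).toOrderHom)
      (Simplex.pull_vertex_zero_le _)

theorem Chains.boundary_apply (F : Sheaf.{u, v, w} R P) (f : Q →o P) (n : ℕ)
    (x : Chains (F.pullback f) (n + 1)) :
    Chains.boundary F f n x = ∑ i : Fin (n + 2), (-1 : ℤ) ^ (i : ℕ) •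
      Chains.reshape F f (Simplex.pull (Fin.succAboveOrderEmb i).toOrderHom)
        (Simplex.pull_vertex_zero_le _) x := by
  simp only [Chains.boundary, LinearMap.sum_apply, LinearMap.smul_apply]

theorem chainComplex_d_eq_boundary (F : Sheaf.{u, v, w} R P) (f : Q →o P) (n : ℕ) :
    ((chainComplex (F.pullback f)).d (n + 1) n).hom = Chains.boundary F f n := by
  refine Chains.hom_ext _ fun σ s => ?_
  refine (chainComplex_d_single (F.pullback f) σ s).trans ?_
  refine Eq.trans ?_ (Chains.boundary_apply F f n _).symm
  refine Finset.sum_congr rfl fun i _ => ?_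
  exact congrArg (fun c : Chains (F.pullback f) n => (-1 : ℤ) ^ (i : ℕ) • c)
    (Chains.reshape_single F f _ (Simplex.pull_vertex_zero_le _) σ s).symm

variable [OrderBot Q]

/-- The simplex `⊥ ≤ x_n ≤ ⋯ ≤ x_0`. -/
def Simplex.snocBot {n : ℕ} (σ : Simplex Q n) : Simplex Q (n + 1) where
  toFun := Fin.snoc (α := fun _ => Qᵒᵈ) σ (OrderDual.toDual ⊥)
  monotone' k l hkl := by
    induction l using Fin.lastCases with
    | last => rw [Fin.snoc_last]; exact (bot_le : (⊥ : Q) ≤ OrderDual.ofDual _)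
    | cast l =>
      induction k using Fin.lastCases with
      | last => exact absurd hkl (not_le.mpr (Fin.castSucc_lt_last l))
      | cast k =>
        rw [Fin.snoc_castSucc, Fin.snoc_castSucc]
        exact σ.monotone (Fin.castSucc_le_castSucc_iff.mp hkl)

theorem Simplex.snocBot_castSucc {n : ℕ} (σ : Simplex Q n) (k : Fin (n + 1)) :
    σ.snocBot k.castSucc = σ k :=
  Fin.snoc_castSucc (α := fun _ => Qᵒᵈ) _ _ k

theorem Simplex.snocBot_last {n : ℕ} (σ : Simplex Q n) :
    σ.snocBot (Fin.last (n + 1)) = OrderDual.toDual ⊥ :=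
  Fin.snoc_last (α := fun _ => Qᵒᵈ) _ _

theorem Simplex.snocBot_vertex_zero_le {n : ℕ} (σ : Simplex Q n) :
    σ.snocBot.vertex 0 ≤ σ.vertex 0 :=
  le_of_eq (congrArg OrderDual.ofDual (σ.snocBot_castSucc 0))

theorem Simplex.pull_last_snocBot {n : ℕ} (σ : Simplex Q n) :
    σ.snocBot.pull (Fin.succAboveOrderEmb (Fin.last (n + 1))).toOrderHom = σ := by
  refine OrderHom.ext _ _ (funext fun k => ?_)
  change σ.snocBot ((Fin.last (n + 1)).succAbove k) = σ k
  rw [Fin.succAbove_last, Simplex.snocBot_castSucc]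

theorem Simplex.pull_castSucc_snocBot {n : ℕ} (σ : Simplex Q (n + 1)) (i : Fin (n + 2)) :
    σ.snocBot.pull (Fin.succAboveOrderEmb i.castSucc).toOrderHom =
      (σ.pull (Fin.succAboveOrderEmb i).toOrderHom).snocBot := by
  refine OrderHom.ext _ _ (funext fun k => ?_)
  change σ.snocBot (i.castSucc.succAbove k) = _
  induction k using Fin.lastCases with
  | last =>
    rw [Simplex.snocBot_last, Fin.succAbove_castSucc_of_le _ _ (Fin.le_last i), Fin.succ_last,
      Simplex.snocBot_last]
  | cast k =>
    rw [Simplex.snocBot_castSucc, Fin.castSucc_succAbove_castSucc, Simplex.snocBot_castSucc]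
    rfl

/-- The contraction `s_{(x_n ≤ ⋯ ≤ x_0)} ↦ s_{(⊥ ≤ x_n ≤ ⋯ ≤ x_0)}`. -/
def Chains.snocBot (F : Sheaf.{u, v, w} R P) (f : Q →o P) (n : ℕ) :
    Chains (F.pullback f) n →ₗ[R] Chains (F.pullback f) (n + 1) :=
  Chains.reshape F f Simplex.snocBot Simplex.snocBot_vertex_zero_le

/-- Every face but the last commutes with appending `⊥`, and the last removes it again, with sign
`(-1)^(n + 2)`. The new vertex sits at the small end, so `x_0` and the coefficient do not change. -/
theorem Chains.boundary_snocBot (F : Sheaf.{u, v, w} R P) (f : Q →o P) (n : ℕ)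
    (x : Chains (F.pullback f) (n + 1)) :
    Chains.boundary F f (n + 1) (Chains.snocBot F f (n + 1) x) =
      Chains.snocBot F f n (Chains.boundary F f n x) +
        (-1 : ℤ) ^ (n + 2) • x := by
  rw [Chains.boundary_apply, Chains.boundary_apply, map_sum, Fin.sum_univ_castSucc]
  congr 1
  · refine Finset.sum_congr rfl fun i _ => ?_
    rw [map_zsmul, Fin.val_castSucc]
    congr 1
    refine (LinearMap.congr_fun (Chains.reshape_comp F f _ Simplex.snocBot_vertex_zero_le _
      (Simplex.pull_vertex_zero_le _)) x).trans ?_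
    refine Eq.trans ?_ (LinearMap.congr_fun (Chains.reshape_comp F f _
      (Simplex.pull_vertex_zero_le _) _ Simplex.snocBot_vertex_zero_le) x).symm
    exact LinearMap.congr_fun (Chains.reshape_congr F f
      (funext fun σ => Simplex.pull_castSucc_snocBot σ i) _ _) x
  · rw [Fin.val_last]
    congr 1
    refine (LinearMap.congr_fun (Chains.reshape_comp F f _ Simplex.snocBot_vertex_zero_le _
      (Simplex.pull_vertex_zero_le _)) x).trans ?_
    refine (LinearMap.congr_fun (Chains.reshape_congr F f
      (funext fun σ => Simplex.pull_last_snocBot σ) _ fun _ => le_rfl) x).trans ?_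
    exact LinearMap.congr_fun (Chains.reshape_id F f _) x

/-- For a `0`-chain the face `0` of `⊥ ≤ x_0` drops the coefficient vertex. It therefore gives the
augmentation of the chain, placed on the vertex `⊥`, which vanishes by `hx`. The other face gives
`-x`. -/
theorem Chains.boundary_snocBot_zero (F : Sheaf.{u, v, w} R P) (f : Q →o P)
    (hm : ∀ x, f ⊥ ≤ f x) (x : Chains (F.pullback f) 0)
    (hx : coneAugmentation F f (f ⊥) hm x = 0) :
    Chains.boundary F f 0 (Chains.snocBot F f 0 x) = -x := by
  have h0 : (Chains.reshape F f (Simplex.pull (Fin.succAboveOrderEmb (0 : Fin 2)).toOrderHom)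
      (Simplex.pull_vertex_zero_le _)).comp (Chains.snocBot F f 0) =
      (Chains.single (F.pullback f) (OrderHom.const _ (OrderDual.toDual ⊥))).comp
        (coneAugmentation F f (f ⊥) hm) := by
    refine Chains.hom_ext _ fun σ s => ?_
    refine (LinearMap.congr_fun (Chains.reshape_comp F f _ Simplex.snocBot_vertex_zero_le _
      (Simplex.pull_vertex_zero_le _)) _).trans ?_
    refine (Chains.reshape_single F f _ (fun σ => (Simplex.pull_vertex_zero_le _ _).trans
      (Simplex.snocBot_vertex_zero_le σ)) σ s).trans ?_
    refine Eq.trans ?_ (congrArg (Chains.single (F.pullback f)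
      (OrderHom.const _ (OrderDual.toDual ⊥))) (coneAugmentation_single F f (f ⊥) hm σ s)).symm
    refine Chains.single_map_congr F f (OrderHom.ext _ _ (funext fun k => ?_)) _ s
    obtain rfl : k = (0 : Fin 1) := Subsingleton.elim (α := Fin 1) _ _
    exact Simplex.snocBot_last σ
  rw [Chains.boundary_apply, Fin.sum_univ_two]
  have h1 : Chains.reshape F f (Simplex.pull (Fin.succAboveOrderEmb (0 : Fin 2)).toOrderHom)
      (Simplex.pull_vertex_zero_le _) (Chains.snocBot F f 0 x) = 0 :=
    (LinearMap.congr_fun h0 x).trans ((congrArg (Chains.single (F.pullback f)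
      (OrderHom.const _ (OrderDual.toDual ⊥))) hx).trans (LinearMap.map_zero _))
  rw [h1, smul_zero, zero_add]
  refine Eq.trans (b := -(Chains.reshape F f
    (Simplex.pull (Fin.succAboveOrderEmb (Fin.last 1)).toOrderHom) (Simplex.pull_vertex_zero_le _)
      (Chains.snocBot F f 0 x))) ?_ (congrArg (- ·) ?_)
  · simp
  · refine (LinearMap.congr_fun (Chains.reshape_comp F f _ Simplex.snocBot_vertex_zero_le _
      (Simplex.pull_vertex_zero_le _)) x).trans ?_
    refine (LinearMap.congr_fun (Chains.reshape_congr F f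
      (funext fun σ => Simplex.pull_last_snocBot σ) _ fun _ => le_rfl) x).trans ?_
    exact LinearMap.congr_fun (Chains.reshape_id F f _) x

theorem coneComplex_exactAt (F : Sheaf.{u, v, w} R P) (f : Q →o P) (hm : ∀ x, f ⊥ ≤ f x) (n : ℕ) :
    (coneComplex F f (f ⊥) hm).ExactAt (n + 1) := by
  rw [HomologicalComplex.exactAt_iff' _ (n + 2) (n + 1) n (by simp) (by simp),
    ShortComplex.moduleCat_exact_iff]
  rcases n with _ | n
  · intro (x : Chains (F.pullback f) 0) hx
    refine ⟨Chains.snocBot F f 0 (-x), ?_⟩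
    refine (LinearMap.congr_fun (chainComplex_d_eq_boundary F f 0) _).trans ?_
    refine (Chains.boundary_snocBot_zero F f hm (-x) ?_).trans (neg_neg x)
    exact (map_neg _ x).trans (neg_eq_zero.mpr hx)
  · intro (x : Chains (F.pullback f) (n + 1)) hx
    -- The factor cancels the sign produced by the last face.
    refine ⟨Chains.snocBot F f (n + 1) ((-1 : ℤ) ^ (n + 2) • x), ?_⟩
    refine (LinearMap.congr_fun (chainComplex_d_eq_boundary F f (n + 1)) _).trans ?_
    have hx' : Chains.boundary F f n x = 0 :=
      (LinearMap.congr_fun (chainComplex_d_eq_boundary F f n) x).symm.trans hx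
    refine (Chains.boundary_snocBot F f n _).trans ?_
    rw [map_zsmul, hx', smul_zero, map_zero, zero_add, smul_smul, ← mul_pow]
    exact (congrArg (· • x) (by simp)).trans (one_zsmul x)

end Contraction

/-! ### Chains on a union and an intersection of subposets -/

section MayerVietoris

variable {R : Type v} [CommRing R] {P Q Q' : Type u} [PartialOrder P] [PartialOrder Q]
  [PartialOrder Q']

open Classical in
/-- The retraction of `Chains.transfer`, which kills the simplices outside the image of `u`. -/
def Chains.retract (F : Sheaf.{u, v, w} R P) (f' : Q' →o P) (f : Q →o P) (u : Q' →o Q)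
    (h : ∀ x, f (u x) = f' x) (n : ℕ) :
    Chains (F.pullback f) n →ₗ[R] Chains (F.pullback f') n :=
  DirectSum.toModule R _ _ fun τ =>
    if hτ : ∃ σ : Simplex Q' n, σ.map u = τ then
      (Chains.single (F.pullback f') hτ.choose).comp
        (F.map (homOfLE ((h _).symm.le.trans
          (le_of_eq (congrArg (fun τ : Simplex Q n => f (τ.vertex 0)) hτ.choose_spec)))).op).hom
    else 0

theorem Simplex.map_injective {u : Q' →o Q} (hu : Function.Injective u) (n : ℕ) :
    Function.Injective (Simplex.map u : Simplex Q' n → Simplex Q n) := fun _ _ h =>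
  OrderHom.ext _ _ (funext fun k => hu (congrArg (fun ρ : Simplex Q n => ρ k) h))

theorem Chains.retract_single_of_eq (F : Sheaf.{u, v, w} R P) (f' : Q' →o P) (f : Q →o P)
    (u : Q' →o Q) (hu : Function.Injective u) (h : ∀ x, f (u x) = f' x) {n : ℕ}
    (σ : Simplex Q' n) (τ : Simplex Q n) (hτ : σ.map u = τ) (s : F.obj (op (f (τ.vertex 0))))
    (hle : f' (σ.vertex 0) ≤ f (τ.vertex 0)) :
    Chains.retract F f' f u h n (Chains.single (F.pullback f) τ s) =
      Chains.single (F.pullback f') σ (F.map (homOfLE hle).op s) := by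
  have hex : ∃ σ : Simplex Q' n, σ.map u = τ := ⟨σ, hτ⟩
  refine (DirectSum.toModule_lof R (M := fun τ : Simplex Q n =>
    (F.pullback f).obj (op (τ.vertex 0))) τ s).trans ?_
  rw [dif_pos hex]
  -- The chosen preimage of `τ` is `σ`, because `u` is injective on simplices.
  exact Chains.single_map_congr F f'
    (Simplex.map_injective hu n (hex.choose_spec.trans hτ.symm)) _ s

theorem Chains.retract_single_of_not (F : Sheaf.{u, v, w} R P) (f' : Q' →o P) (f : Q →o P)
    (u : Q' →o Q) (h : ∀ x, f (u x) = f' x) {n : ℕ} (τ : Simplex Q n)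
    (hτ : ¬ ∃ σ : Simplex Q' n, σ.map u = τ) (s : F.obj (op (f (τ.vertex 0)))) :
    Chains.retract F f' f u h n (Chains.single (F.pullback f) τ s) = 0 := by
  refine (DirectSum.toModule_lof R (M := fun τ : Simplex Q n =>
    (F.pullback f).obj (op (τ.vertex 0))) τ s).trans ?_
  rw [dif_neg hτ]
  rfl

theorem Chains.retract_transfer (F : Sheaf.{u, v, w} R P) (f' : Q' →o P) (f : Q →o P)
    (u : Q' →o Q) (hu : Function.Injective u) (h : ∀ x, f (u x) = f' x) (n : ℕ)
    (x : Chains (F.pullback f') n) :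
    Chains.retract F f' f u h n (Chains.transfer F f' f u (fun x => (h x).le) n x) = x := by
  refine LinearMap.congr_fun (f := (Chains.retract F f' f u h n).comp
    (Chains.transfer F f' f u (fun x => (h x).le) n)) (g := LinearMap.id) ?_ x
  refine Chains.hom_ext _ fun σ s => ?_
  refine (congrArg (Chains.retract F f' f u h n) (Chains.transfer_single F f' f u _ σ s)).trans ?_
  refine (Chains.retract_single_of_eq F f' f u hu h σ _ rfl _ (h _).symm.le).trans ?_
  refine congrArg (Chains.single (F.pullback f') σ) ?_
  exact (F.map_map _ _ s).trans (F.map_self _ s)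

theorem Chains.transfer_injective (F : Sheaf.{u, v, w} R P) (f' : Q' →o P) (f : Q →o P)
    (u : Q' →o Q) (hu : Function.Injective u) (h : ∀ x, f (u x) = f' x) (n : ℕ) :
    Function.Injective (Chains.transfer F f' f u (fun x => (h x).le) n) :=
  Function.LeftInverse.injective (Chains.retract_transfer F f' f u hu h n)

variable {QA QC QD : Type u} [PartialOrder QA] [PartialOrder QC] [PartialOrder QD]

theorem Chains.exists_of_transfer_eq (F : Sheaf.{u, v, w} R P) {f : Q →o P} {fA : QA →o P}
    {fC : QC →o P} {fD : QD →o P} (c : QC →o QA) (d : QC →o QD) (j : QA →o Q) (k : QD →o Q)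
    (hd : Function.Injective d) (hj : Function.Injective j) (hk : Function.Injective k)
    (hcA : ∀ x, fA (c x) = fC x) (hdD : ∀ x, fD (d x) = fC x) (hjf : ∀ x, f (j x) = fA x)
    (hkf : ∀ x, f (k x) = fD x) (comm : ∀ x, j (c x) = k (d x)) (n : ℕ)
    (hpb : ∀ (ρ : Simplex QA n) (τ : Simplex QD n), ρ.map j = τ.map k → ∃ σ : Simplex QC n,
      σ.map d = τ)
    (x : Chains (F.pullback fA) n) (y : Chains (F.pullback fD) n)
    (hxy : Chains.transfer F fA f j (fun x => (hjf x).le) n x =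
      Chains.transfer F fD f k (fun x => (hkf x).le) n y) :
    ∃ w, Chains.transfer F fC fA c (fun x => (hcA x).le) n w = x ∧
      Chains.transfer F fC fD d (fun x => (hdD x).le) n w = y := by
  -- Base change: going from `D` into `Q` and retracting to `A` equals retracting to `C` and
  -- including in `A`. If `τ` does not come from `C`, then by `hpb` its image does not come from
  -- `A`, and both sides vanish.
  have key : (Chains.retract F fA f j hjf n).comp
      (Chains.transfer F fD f k (fun x => (hkf x).le) n) =
      (Chains.transfer F fC fA c (fun x => (hcA x).le) n).comp
        (Chains.retract F fC fD d hdD n) := by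
    refine Chains.hom_ext _ fun τ s => ?_
    refine (congrArg (Chains.retract F fA f j hjf n) (Chains.transfer_single F fD f k _ τ s)).trans
      ?_
    by_cases hτ : ∃ σ : Simplex QC n, σ.map d = τ
    · obtain ⟨σ, rfl⟩ := hτ
      refine Eq.trans ?_ (congrArg (Chains.transfer F fC fA c (fun x => (hcA x).le) n)
        (Chains.retract_single_of_eq F fC fD d hd hdD σ _ rfl s (hdD _).symm.le)).symm
      refine (Chains.retract_single_of_eq F fA f j hj hjf (σ.map c) ((σ.map d).map k)
        (OrderHom.ext _ _ (funext fun i => comm _)) _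
        (((hjf _).symm.trans (congrArg f (comm (σ.vertex 0)))).le)).trans ?_
      refine Eq.trans ?_ (Chains.transfer_single F fC fA c _ σ _).symm
      refine congrArg (Chains.single (F.pullback fA) (σ.map c)) ?_
      exact (F.map_map _ _ s).trans (F.map_map _ _ s).symm
    · refine (Chains.retract_single_of_not F fA f j hjf _ (fun ⟨ρ, hρ⟩ => hτ (hpb ρ τ hρ)) _).trans
        ?_
      refine Eq.trans ?_ (congrArg (Chains.transfer F fC fA c (fun x => (hcA x).le) n)
        (Chains.retract_single_of_not F fC fD d hdD τ hτ s)).symm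
      rw [map_zero]
  have hcd : (Chains.transfer F fA f j (fun x => (hjf x).le) n).comp
      (Chains.transfer F fC fA c (fun x => (hcA x).le) n) =
      (Chains.transfer F fD f k (fun x => (hkf x).le) n).comp
        (Chains.transfer F fC fD d (fun x => (hdD x).le) n) := by
    refine Chains.hom_ext _ fun σ s => ?_
    refine (congrArg (Chains.transfer F fA f j (fun x => (hjf x).le) n)
      (Chains.transfer_single F fC fA c (fun x => (hcA x).le) σ s)).trans ?_
    refine (Chains.transfer_single F fA f j (fun x => (hjf x).le) _ _).trans ?_
    refine Eq.trans ?_ (congrArg (Chains.transfer F fD f k (fun x => (hkf x).le) n)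
      (Chains.transfer_single F fC fD d (fun x => (hdD x).le) σ s)).symm
    refine Eq.trans ?_ (Chains.transfer_single F fD f k (fun x => (hkf x).le) _ _).symm
    refine (congrArg (Chains.single (F.pullback f) _) (F.map_map _ _ s)).trans ?_
    refine Eq.trans ?_ (congrArg (Chains.single (F.pullback f) _) (F.map_map _ _ s)).symm
    exact Chains.single_map_congr F f (OrderHom.ext _ _ (funext fun i => comm _)) _ s
  -- Retracting `hxy` to `A` and applying `key` shows that this element maps to `x`. That it maps to
  -- `y` can be checked in `Q`, since `k` is injective.
  refine ⟨Chains.retract F fC fD d hdD n y, ?_⟩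
  have hx : Chains.transfer F fC fA c (fun x => (hcA x).le) n (Chains.retract F fC fD d hdD n y) =
      x := by
    rw [← Chains.retract_transfer F fA f j hj hjf n x, hxy]
    exact (LinearMap.congr_fun key y).symm
  refine ⟨hx, Chains.transfer_injective F fD f k hk hkf n ?_⟩
  rw [← hxy]
  refine (LinearMap.congr_fun hcd _).symm.trans ?_
  exact congrArg (Chains.transfer F fA f j (fun x => (hjf x).le) n) hx

theorem Chains.exists_transfer_add_transfer_eq (F : Sheaf.{u, v, w} R P) {f : Q →o P}
    {fA : QA →o P} {fD : QD →o P} (j : QA →o Q) (k : QD →o Q)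
    (hjf : ∀ x, f (j x) = fA x) (hkf : ∀ x, f (k x) = fD x) (n : ℕ)
    (hcov : ∀ σ : Simplex Q n, (∃ ρ : Simplex QA n, ρ.map j = σ) ∨
      ∃ τ : Simplex QD n, τ.map k = σ) (z : Chains (F.pullback f) n) :
    ∃ x y, Chains.transfer F fA f j (fun x => (hjf x).le) n x +
      Chains.transfer F fD f k (fun x => (hkf x).le) n y = z := by
  induction z using DirectSum.induction_on with
  | zero => exact ⟨0, 0, by simp⟩
  | of σ s =>
    rcases hcov σ with ⟨ρ, rfl⟩ | ⟨τ, rfl⟩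
    · refine ⟨Chains.single (F.pullback fA) ρ (F.map (homOfLE (hjf _).symm.le).op s), 0, ?_⟩
      rw [map_zero, add_zero]
      refine (Chains.transfer_single F fA f j _ ρ _).trans ?_
      exact congrArg (Chains.single (F.pullback f) _) ((F.map_map _ _ s).trans (F.map_self _ s))
    · refine ⟨0, Chains.single (F.pullback fD) τ (F.map (homOfLE (hkf _).symm.le).op s), ?_⟩
      rw [map_zero, zero_add]
      refine (Chains.transfer_single F fD f k _ τ _).trans ?_
      exact congrArg (Chains.single (F.pullback f) _) ((F.map_map _ _ s).trans (F.map_self _ s))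
  | add z z' hz hz' =>
    obtain ⟨x, y, rfl⟩ := hz
    obtain ⟨x', y', rfl⟩ := hz'
    exact ⟨x + x', y + y', by rw [map_add, map_add]; abel⟩

end MayerVietoris

/-! ### From surjectivity on the colimit to exactness in degree zero -/

section Surjective

variable {R : Type v} [CommRing R] {P : Type u} [PartialOrder P] [OrderBot P]

/-- Each structure map to `F(0)` dies in the cokernel of the augmentation, hence so does `ε_*` by
the universal property of the colimit. As `ε_*` is onto, the cokernel is zero. -/
theorem augmentation_surjective (F : Sheaf.{u, v, w} R P)
    (h : Function.Surjective (epsilonStar F)) : Function.Surjective (augmentation F) := by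
  let q : F.obj (op ⊥) ⟶ ModuleCat.of R (F.obj (op ⊥) ⧸ LinearMap.range (augmentation F)) :=
    ModuleCat.ofHom (LinearMap.range (augmentation F)).mkQ
  have hq : epsilonStar F ≫ q = 0 := by
    refine Limits.colimit.hom_ext fun x => ?_
    refine (Category.assoc _ _ _).symm.trans ((congrArg (· ≫ q)
      (Limits.colimit.ι_desc (augmentationCocone F) x)).trans
        (Eq.trans ?_ Limits.comp_zero.symm))
    ext1
    refine LinearMap.ext fun s => ?_
    refine (Submodule.Quotient.mk_eq_zero _).mpr ⟨Chains.single (F.restrict (punctured P))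
      (OrderHom.const _ (OrderDual.toDual x.unop)) s, ?_⟩
    exact augmentation_single F (OrderHom.const _ (OrderDual.toDual x.unop)) s
  intro y
  obtain ⟨x, rfl⟩ := h y
  exact (Submodule.Quotient.mk_eq_zero _).mp (congrArg (fun φ :
    Limits.colimit (F.restrict (punctured P)) ⟶ ModuleCat.of R (F.obj (op ⊥) ⧸
      LinearMap.range (augmentation F)) => φ x) hq)

theorem augmentedComplex_exactAt_zero (F : Sheaf.{u, v, w} R P)
    (h : Function.Surjective (epsilonStar F)) : (augmentedComplex F).ExactAt 0 := by
  -- The second `0` is the default successor of degree `0`. The outgoing differential is zero there,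
  -- so exactness means surjectivity of the augmentation.
  rw [HomologicalComplex.exactAt_iff' _ 1 0 0 (by simp) (by simp),
    ShortComplex.moduleCat_exact_iff]
  intro y _
  exact augmentation_surjective F h y

end Surjective

/-! ### The retraction of the lattice onto the deletion -/

section Core

variable {L : Type u} [Lattice L] [OrderBot L] [Finite L]

open Classical in
/-- The join of the atoms below `x` which are different from `a`. -/
def core (a x : L) : L :=
  letI := Fintype.ofFinite L
  ((Finset.univ : Finset L).filter fun b => IsAtom b ∧ b ≠ a ∧ b ≤ x).sup id

theorem core_isLUB (a x : L) : IsLUB {b | IsAtom b ∧ b ≠ a ∧ b ≤ x} (core a x) := by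
  classical
  let _ := Fintype.ofFinite L
  have := Finset.isLUB_sup_id (s := (Finset.univ : Finset L).filter
    fun b => IsAtom b ∧ b ≠ a ∧ b ≤ x)
  simpa [core] using this

theorem core_le (a x : L) : core a x ≤ x :=
  (core_isLUB a x).2 fun _ hb => hb.2.2

theorem core_mono (a : L) : Monotone (core a) := fun x y h =>
  (core_isLUB a x).2 fun _ hb => (core_isLUB a y).1 ⟨hb.1, hb.2.1, hb.2.2.trans h⟩

theorem core_mem_deletion (a x : L) : core a x ∈ deletion a :=
  ⟨_, fun _ hb => ⟨hb.1, hb.2.1⟩, core_isLUB a x⟩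

theorem core_eq_self {a x : L} (hx : x ∈ deletion a) : core a x = x := by
  obtain ⟨S, hS, hlub⟩ := hx
  exact le_antisymm (core_le a x) (hlub.2 fun b hb =>
    (core_isLUB a x).1 ⟨(hS b hb).1, (hS b hb).2, hlub.1 hb⟩)

/-- If the join were `⊥`, the only possible atom below `x` would be `a`. As `x` is the join of the
atoms below it, `x ≤ a` would follow, so `x` would be `⊥` or `a`. -/
theorem core_ne_bot [IsAtomistic L] {a x : L} (ha : IsAtom a) (hx : x ≠ ⊥) (hxa : x ≠ a) :
    core a x ≠ ⊥ := by
  intro h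
  have hle : x ≤ a := (isLUB_atoms_le x).2 fun b hb => by
    by_contra hba
    exact hb.1.1 (le_bot_iff.mp (h ▸ (core_isLUB a x).1 ⟨hb.1, fun e => hba e.le, hb.2⟩))
  rcases ha.le_iff.mp hle with h | h
  · exact hx h
  · exact hxa h

end Core

/-! ### The square attached to an atom -/

section Main

variable {R : Type v} [CommRing R] {L : Type u} [Lattice L] [OrderBot L]

/-- The elements of `L` different from the minimum and from `a`. -/
def remainder (a : L) : Set L := {x | x ≠ ⊥ ∧ x ≠ a}

/-- The only atom below `a` is `a` itself, so only the empty join remains, and it is `⊥`. -/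
theorem not_mem_deletion_self {a : L} (ha : IsAtom a) : a ∉ deletion a := by
  rintro ⟨S, hS, hlub⟩
  refine ha.1 (le_bot_iff.mp (hlub.2 fun b hb => absurd ?_ (hS b hb).2))
  exact (ha.le_iff.mp (hlub.1 hb)).resolve_left (hS b hb).1.1

/-- The inclusion of `L_a ∖ 0` in `L ∖ {0, a}`. -/
def deletionToRemainder {a : L} (ha : IsAtom a) : punctured (deletion a) →o remainder a where
  toFun x := ⟨x.1.1, fun h => x.2 (Subtype.ext h), fun h =>
    not_mem_deletion_self ha (Set.mem_of_eq_of_mem h.symm x.1.2)⟩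
  monotone' _ _ h := h

/-- The retraction of `L ∖ {0, a}` onto `L_a ∖ 0`. -/
def remainderToDeletion [Finite L] [IsAtomistic L] {a : L} (ha : IsAtom a) :
    remainder a →o punctured (deletion a) where
  toFun x := ⟨⟨core a x, core_mem_deletion a x⟩, fun h =>
    core_ne_bot ha x.2.1 x.2.2 (congrArg Subtype.val h)⟩
  monotone' _ _ h := core_mono a h

/-- The inclusion of `L ∖ {0, a}` in `L ∖ 0`. -/
def remainderToPunctured (a : L) : remainder a →o punctured L where
  toFun x := ⟨x.1, x.2.1⟩
  monotone' _ _ h := h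

/-- The inclusion of `L^a` in `L ∖ 0`. -/
def restrictionToPunctured {a : L} (ha : IsAtom a) : restriction a →o punctured L where
  toFun x := ⟨x.1, fun h => ha.1 (le_bot_iff.mp (h ▸ x.2))⟩
  monotone' _ _ h := h

/-- The inclusion of `L^a ∖ a` in `L ∖ {0, a}`. -/
def puncturedRestrictionToRemainder {a : L} (ha : IsAtom a) :
    punctured (restriction a) →o remainder a where
  toFun x := ⟨x.1.1, fun h => ha.1 (le_bot_iff.mp (h ▸ x.1.2)), fun h => x.2 (Subtype.ext h)⟩
  monotone' _ _ h := h

theorem exists_simplex_of_map_eq {a : L} (ha : IsAtom a) {n : ℕ} (ρ : Simplex (remainder a) n)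
    (τ : Simplex (restriction a) n)
    (h : ρ.map (remainderToPunctured a) = τ.map (restrictionToPunctured ha)) :
    ∃ σ : Simplex (punctured (restriction a)) n,
      σ.map (OrderHom.Subtype.val (· ∈ punctured (restriction a))) = τ := by
  have hval (i : Fin (n + 1)) : (ρ.vertex i : L) = τ.vertex i :=
    congrArg (fun κ : Simplex (punctured L) n => (κ.vertex i : L)) h
  exact ⟨⟨fun i => OrderDual.toDual ⟨τ.vertex i, fun e =>
    (ρ.vertex i).2.2 ((hval i).trans (congrArg Subtype.val e))⟩,
    fun _ _ hij => τ.monotone hij⟩, rfl⟩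

/-- The least vertex `x_n` decides. If it is `a`, the whole chain lies above `a`. Otherwise no
vertex is `a`, since `0 ≠ x_n ≤ a` would force `x_n = a`. -/
theorem exists_simplex_map_eq {a : L} (ha : IsAtom a) {n : ℕ} (σ : Simplex (punctured L) n) :
    (∃ ρ : Simplex (remainder a) n, ρ.map (remainderToPunctured a) = σ) ∨
      ∃ τ : Simplex (restriction a) n, τ.map (restrictionToPunctured ha) = σ := by
  have hle (i : Fin (n + 1)) : (σ.vertex (Fin.last n) : L) ≤ σ.vertex i :=
    σ.monotone (Fin.le_last i)
  by_cases h : (σ.vertex (Fin.last n) : L) = a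
  · exact Or.inr ⟨⟨fun i => OrderDual.toDual ⟨σ.vertex i, h ▸ hle i⟩,
      fun _ _ hij => σ.monotone hij⟩, rfl⟩
  · refine Or.inl ⟨⟨fun i => OrderDual.toDual ⟨σ.vertex i, (σ.vertex i).2, fun e => ?_⟩,
      fun _ _ hij => σ.monotone hij⟩, rfl⟩
    rcases ha.le_iff.mp (e ▸ hle i) with h' | h'
    · exact (σ.vertex (Fin.last n)).2 h'
    · exact h h'

/-- The inclusion of `L_a ∖ 0` in `L`. -/
def deletionVal (a : L) : punctured (deletion a) →o L :=
  (OrderHom.Subtype.val (· ∈ deletion a)).comp (OrderHom.Subtype.val (· ∈ punctured (deletion a)))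

/-- The inclusion of `L ∖ {0, a}` in `L`. -/
def remainderVal (a : L) : remainder a →o L := OrderHom.Subtype.val (· ∈ remainder a)

/-- The inclusion of `L ∖ 0` in `L`. -/
def puncturedVal (L : Type u) [Lattice L] [OrderBot L] : punctured L →o L :=
  OrderHom.Subtype.val (· ∈ punctured L)

/-- The inclusion of `L^a` in `L`. -/
def restrictionVal (a : L) : restriction a →o L := OrderHom.Subtype.val (· ∈ restriction a)

/-- The inclusion of `L^a ∖ a` in `L^a`. -/
def puncturedRestrictionIncl (a : L) : punctured (restriction a) →o restriction a :=
  OrderHom.Subtype.val (· ∈ punctured (restriction a))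

theorem bot_le_apply {Q : Type u} [PartialOrder Q] (f : Q →o L) (x : Q) : ⊥ ≤ f x := bot_le

/-- The chain map induced by the inclusion of `L_a ∖ 0` in `L ∖ {0, a}`. -/
def deletionTransfer (F : Sheaf.{u, v, w} R L) {a : L} (ha : IsAtom a) :
    coneComplex F (deletionVal a) ⊥ (bot_le_apply _) ⟶
      coneComplex F (remainderVal a) ⊥ (bot_le_apply _) :=
  coneTransfer F (bot_le_apply _) (bot_le_apply _) (deletionToRemainder ha)
    (fun _ => le_rfl) le_rfl

/-- The chain map induced by the inclusion of `L ∖ {0, a}` in `L ∖ 0`. -/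
def remainderTransfer (F : Sheaf.{u, v, w} R L) (a : L) :
    coneComplex F (remainderVal a) ⊥ (bot_le_apply _) ⟶
      coneComplex F (puncturedVal L) ⊥ (bot_le_apply _) :=
  coneTransfer F (bot_le_apply _) (bot_le_apply _) (remainderToPunctured a)
    (fun _ => le_rfl) le_rfl

theorem deletionTransfer_comp_remainderTransfer (F : Sheaf.{u, v, w} R L) {a : L}
    (ha : IsAtom a) : deletionTransfer F ha ≫ remainderTransfer F a =
      augmentedComplexMap F (deletionIncl a) (deletionIncl_ne_bot a) := by
  refine (coneTransfer_comp F (bot_le_apply (deletionVal a)) (bot_le_apply (remainderVal a))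
    (bot_le_apply (puncturedVal L)) (deletionToRemainder ha) (remainderToPunctured a)
    (fun _ => le_rfl) (fun _ => le_rfl) le_rfl le_rfl).trans ?_
  ext1 n
  rcases n with _ | n
  · rfl
  · ext1
    refine Chains.hom_ext _ fun σ s => ?_
    refine (Chains.transfer_single F (deletionVal a) (puncturedVal L)
      ((remainderToPunctured a).comp (deletionToRemainder ha)) (fun _ => le_rfl) σ s).trans ?_
    refine (congrArg (Chains.single (F.restrict (punctured L)) _) (F.map_self _ s)).trans ?_
    exact (Chains.push_single (F.restrict (punctured L))
      (puncturedMap (deletionIncl a) (deletionIncl_ne_bot a)) σ s).symm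

/-- The inverse is induced by `core a`. It fixes `L_a`, so one composite is the identity on chains.
The other comes from a map below the identity of `L ∖ {0, a}` and is homotopic to the identity. -/
theorem isIso_homologyMap_deletionTransfer [Finite L] [IsAtomistic L] (F : Sheaf.{u, v, w} R L)
    {a : L} (ha : IsAtom a) (n : ℕ) :
    IsIso (HomologicalComplex.homologyMap (deletionTransfer F ha) n) := by
  have hr (x : remainder a) : deletionVal a (remainderToDeletion ha x) ≤ remainderVal a x :=
    core_le a x.1
  let r : coneComplex F (remainderVal a) ⊥ (bot_le_apply _) ⟶
      coneComplex F (deletionVal a) ⊥ (bot_le_apply _) :=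
    coneTransfer F (bot_le_apply _) (bot_le_apply _) (remainderToDeletion ha) hr le_rfl
  refine ⟨HomologicalComplex.homologyMap r n, ?_, ?_⟩
  · have : deletionTransfer F ha ≫ r = 𝟙 _ :=
      (coneTransfer_comp F (bot_le_apply (deletionVal a)) (bot_le_apply (remainderVal a))
        (bot_le_apply (deletionVal a)) (deletionToRemainder ha) (remainderToDeletion ha)
        (fun _ => le_rfl) hr le_rfl le_rfl).trans
      (coneTransfer_id F (bot_le_apply (deletionVal a)) _
        (OrderHom.ext _ _ (funext fun x => Subtype.ext (Subtype.ext (core_eq_self x.1.2)))) _ _)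
    rw [← HomologicalComplex.homologyMap_comp, this, HomologicalComplex.homologyMap_id]
  · rw [← HomologicalComplex.homologyMap_comp]
    refine (congrArg (HomologicalComplex.homologyMap · n)
      (coneTransfer_comp F (bot_le_apply (remainderVal a)) (bot_le_apply (deletionVal a))
        (bot_le_apply (remainderVal a)) (remainderToDeletion ha) (deletionToRemainder ha)
        hr (fun _ => le_rfl) le_rfl le_rfl)).trans ?_
    exact homologyMap_coneTransfer_of_le F (bot_le_apply (remainderVal a))
      ((deletionToRemainder ha).comp (remainderToDeletion ha)) (fun x => core_le a x.1) _ _ n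

theorem exists_longExact [Finite L] [IsAtomistic L] (F : Sheaf.{u, v, w} R L) {a : L}
    (ha : IsAtom a) (hC : ∀ x, a ≤ (restrictionVal a).comp (puncturedRestrictionIncl a) x)
    (hε : (coneComplex F ((restrictionVal a).comp (puncturedRestrictionIncl a)) a hC).ExactAt 0) :
    ∃ (α : ∀ i : ℕ, (coneComplex F ((restrictionVal a).comp (puncturedRestrictionIncl a)) a
          hC).homology (i + 1) ⟶
          (coneComplex F (deletionVal a) ⊥ (bot_le_apply _)).homology (i + 1))
      (δ : ∀ i : ℕ, (coneComplex F (puncturedVal L) ⊥ (bot_le_apply _)).homology (i + 1 + 1) ⟶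
          (coneComplex F ((restrictionVal a).comp (puncturedRestrictionIncl a)) a
            hC).homology (i + 1)),
      (∀ i, Function.Exact (α i) (HomologicalComplex.homologyMap
        (deletionTransfer F ha ≫ remainderTransfer F a) (i + 1))) ∧
      (∀ i, Function.Exact (HomologicalComplex.homologyMap
        (deletionTransfer F ha ≫ remainderTransfer F a) (i + 1 + 1)) (δ i)) ∧
      (∀ i, Function.Exact (δ i) (α i)) ∧
      Function.Surjective (HomologicalComplex.homologyMap
        (deletionTransfer F ha ≫ remainderTransfer F a) (0 + 1)) := by
  have hD (x) : a ≤ restrictionVal a x := x.2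
  have inj_d : Function.Injective (puncturedRestrictionIncl a) := Subtype.val_injective
  have inj_j : Function.Injective (remainderToPunctured a) := fun _ _ h =>
    Subtype.ext (congrArg (fun y : punctured L => (y : L)) h)
  have inj_k : Function.Injective (restrictionToPunctured ha) := fun _ _ h =>
    Subtype.ext (congrArg (fun y : punctured L => (y : L)) h)
  refine exists_longExact_of_square
    (coneTransfer F hC (bot_le_apply (remainderVal a)) (puncturedRestrictionToRemainder ha)
      (fun _ => le_rfl) bot_le)
    (coneTransfer F hC hD (puncturedRestrictionIncl a) (fun _ => le_rfl) le_rfl)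
    (remainderTransfer F a)
    (coneTransfer F hD (bot_le_apply (puncturedVal L)) (restrictionToPunctured ha)
      (fun _ => le_rfl) bot_le) ?_ ?_ ?_ ?_ ?_ hε (deletionTransfer F ha)
    (isIso_homologyMap_deletionTransfer F ha)
  · exact (coneTransfer_comp F hC (bot_le_apply (remainderVal a)) (bot_le_apply (puncturedVal L))
      (puncturedRestrictionToRemainder ha) (remainderToPunctured a) (fun _ => le_rfl)
      (fun _ => le_rfl) bot_le le_rfl).trans
      (coneTransfer_comp F hC hD (bot_le_apply (puncturedVal L)) (puncturedRestrictionIncl a)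
        (restrictionToPunctured ha) (fun _ => le_rfl) (fun _ => le_rfl) le_rfl bot_le).symm
  · rintro (_ | n)
    · exact fun x y h => (F.map_self le_rfl x).symm.trans (h.trans (F.map_self le_rfl y))
    · exact Chains.transfer_injective F _ (restrictionVal a) (puncturedRestrictionIncl a) inj_d
        (fun _ => rfl) n
  -- In degree `0` the square has identities `F(a) → F(a)` and `F(0) → F(0)` on opposite sides, so
  -- `y` itself is the common preimage.
  · rintro (_ | n) x y h
    · exact ⟨y, h.symm.trans (F.map_self le_rfl x), F.map_self le_rfl y⟩
    · exact Chains.exists_of_transfer_eq F (f := puncturedVal L) (fA := remainderVal a)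
        (fC := (restrictionVal a).comp (puncturedRestrictionIncl a)) (fD := restrictionVal a)
        (puncturedRestrictionToRemainder ha) (puncturedRestrictionIncl a)
        (remainderToPunctured a) (restrictionToPunctured ha) inj_d inj_j inj_k
        (fun _ => rfl) (fun _ => rfl) (fun _ => rfl) (fun _ => rfl) (fun _ => rfl) n
        (fun ρ τ h => exists_simplex_of_map_eq ha ρ τ h) x y h
  · rintro (_ | n) z
    · refine ⟨z, 0, ?_⟩
      rw [map_zero, add_zero]
      exact F.map_self le_rfl z
    · exact Chains.exists_transfer_add_transfer_eq F (f := puncturedVal L) (fA := remainderVal a)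
        (fD := restrictionVal a) (remainderToPunctured a) (restrictionToPunctured ha)
        (fun _ => rfl) (fun _ => rfl) n (exists_simplex_map_eq ha) z
  · exact coneComplex_exactAt F (restrictionVal a) hD

end Main

end PosetSheaf

end

/-! ### The long exact sequence -/

open PosetSheaf in
theorem mainTheorem2 {R : Type v} [CommRing R] {L : Type u} [Lattice L] [BoundedOrder L]
    [Finite L] [GradeMinOrder ℕ L] [IsAtomistic L] (F : Sheaf.{u, v, w} R L) (a : L)
    (ha : IsAtom a) (hε : Function.Surjective (epsilonStar (F.restrict (restriction a)))) :
    ∃ (α : ∀ i : ℕ, reducedHomology (F.restrict (restriction a)) i ⟶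
          reducedHomology (F.restrict (deletion a)) i)
      (δ : ∀ i : ℕ, reducedHomology F (i + 1) ⟶
          reducedHomology (F.restrict (restriction a)) i),
      (∀ i, Function.Exact (α i) (inclusionMap F a i)) ∧
      (∀ i, Function.Exact (inclusionMap F a (i + 1)) (δ i)) ∧
      (∀ i, Function.Exact (δ i) (α i)) ∧
      Function.Surjective (inclusionMap F a 0) := by
  have h := exists_longExact F ha (fun x => x.1.2) (augmentedComplex_exactAt_zero _ hε)
  rw [deletionTransfer_comp_remainderTransfer] at h
  -- The reduced complexes of `F` restricted to `L^a` and `L_a` unfold to cone complexes over `L`,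
  -- with lower bounds `a` and `⊥`, so the statements agree definitionally.
  exact h
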